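/- **Notions.** A *causal operational-probabilistic theory* consists of systems with a trivial system $I$ and composite systems, and of *tests* $\{\mathcal C_i\}_{i\in O}$ from a system $A$ to a system $B$ with finite outcome sets $O$, whose members are called *events*. Systems and events form part of a symmetric monoidal category, the identity and structural morphisms are one-outcome tests, and tests are closed under sequential and parallel composition, with pairs of outcomes as outcomes. Every test from $I$ to $I$ is a probability distribution on its outcome set, and such tests compose to product distributions. Every system $A$ has a deterministic effect, i.e. a one-outcome test $\top_A$ from $A$ to $I$, and it is unique up to operational equivalence: for every event $\rho$ from $I$ to $A$ and every test $\{a_i\}_{i}$ from $A$ to $I$, the sum over $i$ of the probabilities of $\rho$ followed by $a_i$ equals the probability of $\rho$ followed by $\top_A$ (causality). A *generalised DAG* $G$ is a finite directed acyclic graph whose nodes are partitioned into observed and unobserved nodes; an edge is *unobserved* if it begins on an unobserved node. Let each observed node carry a random variable with a finite set of values. A joint probability distribution $P$ of these variables is *generalised Markov* with respect to $G$ if there are a causal operational-probabilistic theory, a system for each unobserved edge (each edge being a wire of its own), and, for each node and each value of the variables at its observed parents, a test from the composite of the systems on the incoming unobserved edges of the node to the composite of the systems on its outgoing unobserved edges,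 whose outcome set is the set of values of the node's variable if the node is observed and has one element if it is unobserved, such that for every joint value $x$ of the observed variables $P(x)$ is the probability of the closed circuit obtained by connecting, along the unobserved edges, the events selected by $x$. For a set $U$ of nodes let $m(U)$ be the union of $U$ with all children of nodes of $U$. For disjoint sets $X,Y,Z$ of nodes let $W$ be the set of nodes that are neither in $X\cup Y\cup Z$ nor ancestors of a node of $X\cup Y\cup Z$. A *pseudo-path* from $p_1$ to $p_k$ is a finite sequence of nodes $(p_1,\dots,p_k)$, $k \ge 1$, with $p_i\notin W$ for $1\le i\le k$ and $m(\{p_i\})\cap m(\{p_{i+1}\})\not\subseteq W$ for $1\le i<k$. The sets $X$ and $Y$ are *$d$-separated* by $Z$ if, for all $a\in X$ and $b\in Y$, every pseudo-path from $a$ to $b$ contains a node of $Z$. For disjoint sets $X,Y,Z$ of observed nodes, $X\perp Y\mid Z$ in $P$ means that $P(x,y\mid z)=P(x\mid z)\,P(y\mid z)$ for all values $x,y,z$ of the variables in $X,Y,Z$ with $P(z)>0$. **Theorem.** Let $G$ be a generalised DAG and let $X$, $Y$, $Z$ be pairwise disjoint sets of observed nodes of $G$. (i) If $P$ is generalised Markov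 with respect to $G$ and $X$ and $Y$ are $d$-separated by $Z$, then $X\perp Y\mid Z$ in $P$. (ii) If $X\perp Y\mid Z$ holds in every $P$ (for all choices of finite value sets of the observed variables) that is generalised Markov with respect to $G$, then $X$ and $Y$ are $d$-separated by $Z$. -/

import Mathlib

open CategoryTheory MonoidalCategory

universe u w

/-! ### Causal operational-probabilistic theories -/

/-- A causal operational-probabilistic theory whose systems are the objects of a symmetric monoidal
category `C` (`⊗` forms composite systems, `𝟙_ C` is the trivial system, `≫` and `⊗ₘ` are sequential
and parallel composition). The *tests* are distinguished finite families of morphisms; the *events*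
are the morphisms that occur in some test. Morphisms of `C` that occur in no test play no role. -/
structure CausalOPT (C : Type (u + 1)) [LargeCategory C] [MonoidalCategory C]
    [SymmetricCategory C] where
  /-- `IsTest t`: the family of events `t`, indexed by the finite outcome set `X`, is a test. -/
  IsTest : ∀ {X : Type} [Finite X] {A B : C}, (X → (A ⟶ B)) → Prop
  /-- Doing nothing, and the structural rewirings, are deterministic tests. -/
  isTest_id : ∀ A : C, IsTest (fun _ : Unit => 𝟙 A)
  isTest_associator_hom : ∀ A B D : C, IsTest (fun _ : Unit => (α_ A B D).hom)
  isTest_associator_inv : ∀ A B D : C, IsTest (fun _ : Unit => (α_ A B D).inv)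
  isTest_leftUnitor_hom : ∀ A : C, IsTest (fun _ : Unit => (λ_ A).hom)
  isTest_leftUnitor_inv : ∀ A : C, IsTest (fun _ : Unit => (λ_ A).inv)
  isTest_rightUnitor_hom : ∀ A : C, IsTest (fun _ : Unit => (ρ_ A).hom)
  isTest_rightUnitor_inv : ∀ A : C, IsTest (fun _ : Unit => (ρ_ A).inv)
  isTest_braiding : ∀ A B : C, IsTest (fun _ : Unit => (β_ A B).hom)
  /-- Sequential composition of tests; outcomes are ordered pairs. -/
  isTest_comp : ∀ {X Y : Type} [Finite X] [Finite Y] {A B D : C} (s : X → (A ⟶ B))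
    (t : Y → (B ⟶ D)), IsTest s → IsTest t → IsTest (fun p : X × Y => s p.1 ≫ t p.2)
  /-- Parallel composition of tests; outcomes are ordered pairs. -/
  isTest_tensor : ∀ {X Y : Type} [Finite X] [Finite Y] {A B D E : C} (s : X → (A ⟶ B))
    (t : Y → (D ⟶ E)), IsTest s → IsTest t → IsTest (fun p : X × Y => s p.1 ⊗ₘ t p.2)
  /-- The probability of an event from the trivial system to itself. -/
  prob : (𝟙_ C ⟶ 𝟙_ C) → ℝ
  /-- Every test from the trivial system to itself is a probability distribution. -/
  prob_test : ∀ {X : Type} [Fintype X] (t : X → (𝟙_ C ⟶ 𝟙_ C)), IsTest t →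
    (fun x => prob (t x)) ∈ stdSimplex ℝ X
  /-- Composing tests from the trivial system to itself gives the product distribution (on the
  trivial system sequential and parallel composition agree, up to the unitors). -/
  prob_comp : ∀ {X Y : Type} [Finite X] [Finite Y] (s : X → (𝟙_ C ⟶ 𝟙_ C))
    (t : Y → (𝟙_ C ⟶ 𝟙_ C)), IsTest s → IsTest t →
    ∀ x y, prob (s x ≫ t y) = prob (s x) * prob (t y)
  /-- Causality, existence: every system has a deterministic effect. -/
  exists_deterministic : ∀ A : C, ∃ e : A ⟶ 𝟙_ C, IsTest (fun _ : Unit => e)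
  /-- Causality, uniqueness: ignoring the outcome of any observation-test on `A` has, on every
  preparation-event of `A`, the same probability as any deterministic effect on `A` (for a
  one-outcome observation-test this says that deterministic effects are operationally equal). -/
  deterministic_unique : ∀ {X Y : Type} [Fintype X] [Finite Y] {A : C} (a : X → (A ⟶ 𝟙_ C))
    (e : A ⟶ 𝟙_ C) (r : Y → (𝟙_ C ⟶ A)), IsTest a → IsTest (fun _ : Unit => e) → IsTest r →
    ∀ y, ∑ x, prob (r y ≫ a x) = prob (r y ≫ e)

/-! ### Generalised DAGs and d-separation -/

/-- A generalised DAG: a directed acyclic graph on the nodes `V` with a set of observed nodes; the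
remaining nodes are unobserved. -/
structure GDAG (V : Type w) where
  edge : V → V → Prop
  acyclic : ∀ v, ¬ Relation.TransGen edge v v
  observed : Finset V

namespace GDAG

variable {V : Type w} (G : GDAG V)

/-- The set `U` together with all children of nodes of `U`. -/
def inclusiveChildren (U : Set V) : Set V := {v | v ∈ U ∨ ∃ a ∈ U, G.edge a v}

/-- The set `U` together with all ancestors of nodes of `U`. -/
def inclusiveAncestors (U : Set V) : Set V := {v | ∃ a ∈ U, Relation.ReflTransGen G.edge v a}

/-- `l` is a pseudo-path relative to `W`: it avoids `W`, and consecutive nodes are adjacent, or have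
a common child, outside `W`. -/
def IsPseudoPath (W : Set V) (l : List V) : Prop :=
  (∀ v ∈ l, v ∉ W) ∧
    l.IsChain (fun a b => ¬ (G.inclusiveChildren {a} ∩ G.inclusiveChildren {b} ⊆ W))

/-- `X` and `Y` are d-separated by `Z`: every pseudo-path from `X` to `Y`, relative to the
complement of the inclusive past of `X ∪ Y ∪ Z`, meets `Z`. -/
def DSep (X Y Z : Set V) : Prop :=
  ∀ a ∈ X, ∀ b ∈ Y, ∀ l : List V, G.IsPseudoPath (G.inclusiveAncestors (X ∪ Y ∪ Z))ᶜ l →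
    l.head? = some a → l.getLast? = some b → ∃ v ∈ l, v ∈ Z

/-! ### Wires -/

/-- The unobserved edges, i.e. those that begin on an unobserved node. -/
def UEdge : Type w := {e : V × V // G.edge e.1 e.2 ∧ e.1 ∉ G.observed}

instance [Finite V] : Finite G.UEdge := by unfold UEdge; infer_instance

/-- The unobserved edges into `v`, listed in some order. -/
noncomputable def inWires [Finite V] (v : V) : List G.UEdge :=
  (Set.toFinite {e : G.UEdge | e.1.2 = v}).toFinset.toList

/-- The unobserved edges out of `v`, listed in some order (none if `v` is observed). -/
noncomputable def outWires [Finite V] (v : V) : List G.UEdge :=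
  (Set.toFinite {e : G.UEdge | e.1.1 = v}).toFinset.toList

/-- The outcome set of the node `v`: it is `Ω v` if `v` is observed, and has exactly one element if
`v` is unobserved. -/
abbrev Outcome (Ω : G.observed → Type) (v : V) : Type := ∀ h : v ∈ G.observed, Ω ⟨v, h⟩

/-- Values for the observed parents of `v`. -/
abbrev ParentValue (Ω : G.observed → Type) (v : V) : Type w :=
  ∀ j : {j : G.observed // G.edge j v}, Ω j.1

end GDAG

/-! ### Circuits -/

section Circuits

variable {C : Type (u + 1)} [LargeCategory C] [MonoidalCategory C] {E : Type w}

/-- The composite of the systems carried by a list of wires. -/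
def composite (sys : E → C) : List E → C
  | [] => 𝟙_ C
  | e :: L => sys e ⊗ composite sys L

/-- The composite of a concatenation is the composite of the two composites. -/
def compositeAppend (sys : E → C) (R : List E) :
    ∀ L : List E, composite sys (L ++ R) ≅ composite sys L ⊗ composite sys R
  | [] => (λ_ (composite sys R)).symm
  | e :: L => whiskerLeftIso (sys e) (compositeAppend sys R L) ≪≫
      (α_ (sys e) (composite sys L) (composite sys R)).symm

/-- `Rewiring sys L L' σ`: the morphism `σ` permutes the wires `L` into the order `L'` by crossing
adjacent wires. -/
inductive Rewiring [SymmetricCategory C] (sys : E → C) :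
    ∀ L L' : List E, (composite sys L ⟶ composite sys L') → Prop
  | nil : Rewiring sys [] [] (𝟙 _)
  | cons (e : E) {L L' : List E} {σ : composite sys L ⟶ composite sys L'} :
      Rewiring sys L L' σ → Rewiring sys (e :: L) (e :: L') (sys e ◁ σ)
  | swap (e e' : E) (L : List E) :
      Rewiring sys (e :: e' :: L) (e' :: e :: L)
        ((α_ (sys e) (sys e') (composite sys L)).inv ≫
          (β_ (sys e) (sys e')).hom ▷ composite sys L ≫
          (α_ (sys e') (sys e) (composite sys L)).hom)
  | trans {L L' L'' : List E} {σ : composite sys L ⟶ composite sys L'}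
      {τ : composite sys L' ⟶ composite sys L''} :
      Rewiring sys L L' σ → Rewiring sys L' L'' τ → Rewiring sys L L'' (σ ≫ τ)

end Circuits

/-! ### The generalised Markov condition -/

/-- An assignment, in the theory `T`, of a system to each unobserved edge of `G`, and to each node
`v` and each value of its observed parents of a test from the composite of the systems on the
incoming unobserved edges of `v` to the composite of those on its outgoing unobserved edges. Every
unobserved edge is a wire of its own, distinct from all others, and `sys` is the system it carries:
composition below matches wires by their edge, so two wires may carry copies of one system. -/
structure CircuitModel {C : Type (u + 1)} [LargeCategory C] [MonoidalCategory C]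
    [SymmetricCategory C] (T : CausalOPT C) {V : Type w} [Finite V] (G : GDAG V)
    (Ω : G.observed → Type) [∀ i, Finite (Ω i)] where
  sys : G.UEdge → C
  test : ∀ v : V, G.ParentValue Ω v → G.Outcome Ω v →
    (composite sys (G.inWires v) ⟶ composite sys (G.outWires v))
  isTest : ∀ (v : V) (c : G.ParentValue Ω v), T.IsTest (test v c)

namespace CircuitModel

variable {C : Type (u + 1)} [LargeCategory C] [MonoidalCategory C] [SymmetricCategory C]
  {T : CausalOPT C} {V : Type w} [Fintype V] [DecidableEq V] {G : GDAG V} {Ω : G.observed → Type}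
  [∀ i, Finite (Ω i)] (M : CircuitModel T G Ω)

/-- The event at node `v` when the observed variables take the values `x`. -/
def event (x : ∀ i, Ω i) (v : V) :
    composite M.sys (G.inWires v) ⟶ composite M.sys (G.outWires v) :=
  M.test v (fun j => x j.1) (fun h => x ⟨v, h⟩)

/-- `M.Partial S L f`: composing the events of the nodes in `S`, in causal order, yields for each
value `x` of the observed variables the event `f x`, with the open output wires `L`.
Wires are matched by the edge they belong to; as `C` is symmetric monoidal, the result does not
depend on the order in which the nodes are composed nor on how the wires are crossed. -/
inductive Partial : Finset V → ∀ L : List G.UEdge,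
    ((∀ i, Ω i) → (𝟙_ C ⟶ composite M.sys L)) → Prop
  | empty : Partial ∅ [] (fun _ => 𝟙 _)
  | rewire {S : Finset V} {L L' : List G.UEdge} {f : (∀ i, Ω i) → (𝟙_ C ⟶ composite M.sys L)}
      {σ : composite M.sys L ⟶ composite M.sys L'} :
      Partial S L f → Rewiring M.sys L L' σ → Partial S L' (fun x => f x ≫ σ)
  | node {S : Finset V} (v : V) {R : List G.UEdge}
      {f : (∀ i, Ω i) → (𝟙_ C ⟶ composite M.sys (G.inWires v ++ R))} :
      v ∉ S → (∀ a, G.edge a v → a ∈ S) → Partial S (G.inWires v ++ R) f →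
      Partial (insert v S) (G.outWires v ++ R) (fun x =>
        f x ≫ (compositeAppend M.sys R (G.inWires v)).hom ≫
          M.event x v ▷ composite M.sys R ≫
          (compositeAppend M.sys R (G.outWires v)).inv)

/-- The closed circuit formed by the events of all nodes has, for each value `x` of the observed
variables, probability `P x`. -/
def Realises (P : (∀ i, Ω i) → ℝ) : Prop :=
  ∃ f : (∀ i, Ω i) → (𝟙_ C ⟶ 𝟙_ C),
    M.Partial Finset.univ [] f ∧ ∀ x, P x = T.prob (f x)

end CircuitModel

/-- `P` is generalised Markov with respect to `G`: some causal operational-probabilistic theory has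
systems for the unobserved edges and tests for the nodes whose circuit has probabilities `P`. -/
def GDAG.IsGeneralisedMarkov {V : Type w} [Fintype V] [DecidableEq V] (G : GDAG V)
    {Ω : G.observed → Type} [∀ i, Finite (Ω i)] (P : (∀ i, Ω i) → ℝ) : Prop :=
  ∃ (C : Type (u + 1)) (_ : LargeCategory C) (_ : MonoidalCategory C) (_ : SymmetricCategory C)
    (T : CausalOPT C) (M : CircuitModel T G Ω), M.Realises P

/-! ### Conditional independence -/

section CondIndep

variable {V : Type w} [DecidableEq V] {O : Finset V} {Ω : O → Type} [∀ i, Fintype (Ω i)]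

open Classical in
/-- The marginal probability that the variables in `S` take the values that they have in `a`. -/
noncomputable def marginal (P : (∀ i, Ω i) → ℝ) (S : Set V) (a : ∀ i, Ω i) : ℝ :=
  ∑ x : (∀ i, Ω i) with ∀ i : O, (i : V) ∈ S → x i = a i, P x

/-- `P(x, y | z) = P(x | z) P(y | z)` for all values `x, y, z` of `X`, `Y`, `Z` with `P(z) ≠ 0`. -/
def CondIndepSets (P : (∀ i, Ω i) → ℝ) (X Y Z : Set V) : Prop :=
  ∀ a : ∀ i, Ω i, marginal P Z a ≠ 0 →
    marginal P (X ∪ Y ∪ Z) a / marginal P Z a =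
      (marginal P (X ∪ Z) a / marginal P Z a) * (marginal P (Y ∪ Z) a / marginal P Z a)

end CondIndep

/-!
**Soundness.** By causality a circuit whose open wires are discarded has a weight that does not
change when nodes without outgoing wires are appended and summed over. Hence the marginal of `P`
on the inclusive past `A` of `X ∪ Y ∪ Z` is the weight of the circuit of the nodes in `A`. Let
`D` be the set of nodes that a pseudo-path in `A` reaches from `X` without meeting `Z`. No wire
joins a node of `A` that is in `D` or has a parent in `D` with any other node of `A`, so the
circuit of `A` is the juxtaposition of two circuits. Their weights depend only on the variables
in `D ∪ Z` and on those outside `D`, and this factorisation is the conditional independence.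

**Completeness.** Classical probability theory is a causal operational-probabilistic theory, in
which every node can compute its value from its own fair coin and from the values of its parents.
Let every node collect the bits of the nodes that reach it by directed paths outside `Z`, and let
a node of `Z` tell only whether both bits occur among those. If `X` and `Y` are connected by a
pseudo-path outside `Z` and no node of `Z` sees both bits, then all bits along the path agree. So
a node of `X` that sees only `false` excludes a node of `Y` that sees only `true`, although
either observation has positive probability.
-/

/-! ### Crossing wires -/

section Crossing

variable {C : Type*} [Category* C] [MonoidalCategory C]

theorem whiskerLeft_comp_appendIso (A : C) {B D D' F F' : C} {c : F ≅ B ⊗ D} {c' : F' ≅ B ⊗ D'}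
    {t : D ⟶ D'} {s : F ⟶ F'} (h : s ≫ c'.hom = c.hom ≫ B ◁ t) :
    A ◁ s ≫ (whiskerLeftIso A c' ≪≫ (α_ A B D').symm).hom =
      (whiskerLeftIso A c ≪≫ (α_ A B D).symm).hom ≫ (A ⊗ B) ◁ t := by
  simp only [Iso.trans_hom, whiskerLeftIso_hom, Iso.symm_hom, Category.assoc]
  rw [← associator_inv_naturality_right, ← whiskerLeft_comp_assoc, ← whiskerLeft_comp_assoc, h]

theorem appendIso_comp_rightUnitor (A : C) {B F : C} (c : F ≅ B ⊗ 𝟙_ C) :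
    (whiskerLeftIso A c ≪≫ (α_ A B (𝟙_ C)).symm).hom ≫ (ρ_ (A ⊗ B)).hom =
      A ◁ (c.hom ≫ (ρ_ B).hom) := by
  simp

theorem leftUnitor_inv_comp_tensorHom_comp_leftUnitor_hom (f g : 𝟙_ C ⟶ 𝟙_ C) :
    (λ_ (𝟙_ C)).inv ≫ (f ⊗ₘ g) ≫ (λ_ (𝟙_ C)).hom = f ≫ g := by
  rw [MonoidalCategory.tensorHom_def, Category.assoc, leftUnitor_naturality, unitors_equal,
    rightUnitor_naturality_assoc, ← unitors_equal, Iso.inv_hom_id_assoc]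

variable [BraidedCategory C]

/-- The exchange of the first two of three systems, the basic step of every rewiring. -/
def crossing (A B D : C) : A ⊗ B ⊗ D ⟶ B ⊗ A ⊗ D :=
  (α_ A B D).inv ≫ (β_ A B).hom ▷ D ≫ (α_ B A D).hom

theorem crossing_naturality (A B : C) {D D' : C} (t : D ⟶ D') :
    crossing A B D ≫ B ◁ A ◁ t = A ◁ B ◁ t ≫ crossing A B D' := by
  simp only [crossing, Category.assoc]
  rw [associator_inv_naturality_right_assoc, whisker_exchange_assoc,
    associator_naturality_right]

theorem crossing_naturality_middle (A : C) {B B' : C} (k : B ⟶ B') (D : C) :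
    crossing A B D ≫ k ▷ (A ⊗ D) = A ◁ (k ▷ D) ≫ crossing A B' D := by
  simp only [crossing, Category.assoc]
  rw [← associator_naturality_left, ← comp_whiskerRight_assoc,
    ← BraidedCategory.braiding_naturality_right,
    associator_inv_naturality_middle_assoc, comp_whiskerRight_assoc]

theorem crossing_yang_baxter (A B D F : C) :
    crossing A B (D ⊗ F) ≫ B ◁ crossing A D F ≫ crossing B D (A ⊗ F) =
      A ◁ crossing B D F ≫ crossing A D (B ⊗ F) ≫ D ◁ crossing A B F := by
  calc
    _ = 𝟙 _ ⊗≫ ((α_ A B D).inv ≫ (β_ A B).hom ▷ D ≫ (α_ B A D).hom ≫ B ◁ (β_ A D).hom ≫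
          (α_ B D A).inv ≫ (β_ B D).hom ▷ A ≫ (α_ D B A).hom) ▷ F ⊗≫ 𝟙 _ := by
      simp only [crossing]
      monoidal
    _ = _ := by
      rw [BraidedCategory.yang_baxter]
      simp only [crossing]
      monoidal

theorem crossing_tensor (A B B' D : C) :
    crossing A (B ⊗ B') D = A ◁ (α_ B B' D).hom ≫ crossing A B (B' ⊗ D) ≫
      B ◁ crossing A B' D ≫ (α_ B B' (A ⊗ D)).inv := by
  simp only [crossing, BraidedCategory.braiding_tensor_right_hom]
  monoidal

theorem crossing_unit (A D : C) :
    crossing A (𝟙_ C) D = A ◁ (λ_ D).hom ≫ (λ_ (A ⊗ D)).inv := by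
  simp only [crossing, braiding_tensorUnit_right]
  monoidal

theorem crossing_conj_unit (A D : C) :
    A ◁ (λ_ D).symm.hom ≫ crossing A (𝟙_ C) D ≫ (λ_ (A ⊗ D)).symm.inv = 𝟙 _ := by
  simp [crossing_unit]

theorem crossing_conj_appendIso (A A' : C) {B D F F' : C} (c : F ≅ B ⊗ D)
    (c' : F' ≅ B ⊗ A ⊗ D) :
    A ◁ (whiskerLeftIso A' c ≪≫ (α_ A' B D).symm).hom ≫ crossing A (A' ⊗ B) D ≫
      (whiskerLeftIso A' c' ≪≫ (α_ A' B (A ⊗ D)).symm).inv =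
      crossing A A' F ≫ A' ◁ (A ◁ c.hom ≫ crossing A B D ≫ c'.inv) := by
  have h := crossing_naturality A A' c.hom
  simp only [crossing_tensor, Iso.symm_hom, Iso.symm_inv, Iso.trans_hom, Iso.trans_inv,
    whiskerLeftIso_hom, whiskerLeftIso_inv, MonoidalCategory.whiskerLeft_comp, Category.assoc,
    Iso.inv_hom_id_assoc, whiskerLeft_inv_hom_assoc, reassoc_of% h]

theorem crossing_conj_naturality (A : C) {B B' D F F' H H' : C} (k : B ⟶ B') (c : F ≅ B ⊗ D)
    (c' : F' ≅ B' ⊗ D) (d : H ≅ B ⊗ A ⊗ D) (d' : H' ≅ B' ⊗ A ⊗ D) :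
    (A ◁ c.hom ≫ crossing A B D ≫ d.inv) ≫ d.hom ≫ k ▷ (A ⊗ D) ≫ d'.inv =
      A ◁ (c.hom ≫ k ▷ D ≫ c'.inv) ≫ A ◁ c'.hom ≫ crossing A B' D ≫ d'.inv := by
  have h := crossing_naturality_middle A k D
  simp only [MonoidalCategory.whiskerLeft_comp, Category.assoc, Iso.inv_hom_id_assoc,
    whiskerLeft_inv_hom_assoc, reassoc_of% h]

theorem crossing_crossing {C : Type*} [Category* C] [MonoidalCategory C] [SymmetricCategory C]
    (A B D : C) : crossing A B D ≫ crossing B A D = 𝟙 _ := by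
  simp [crossing, ← comp_whiskerRight_assoc]

end Crossing

section Rewiring

variable {C : Type (u + 1)} [LargeCategory C] [MonoidalCategory C] {E : Type w} (sys : E → C)

/-- A morphism of composites, with one further wire `e` in front. -/
def consWire (e : E) {L L' : List E} (t : composite sys L ⟶ composite sys L') :
    composite sys (e :: L) ⟶ composite sys (e :: L') :=
  sys e ◁ t

/-- The morphism of composites that crosses the first two wires. -/
def crossWires [BraidedCategory C] (e e' : E) (L : List E) :
    composite sys (e :: e' :: L) ⟶ composite sys (e' :: e :: L) :=
  crossing (sys e) (sys e') (composite sys L)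

variable {sys}

theorem consWire_id (e : E) (L : List E) : consWire sys e (𝟙 (composite sys L)) = 𝟙 _ :=
  whiskerLeft_id _ _

theorem consWire_comp (e : E) {L L' L'' : List E} (s : composite sys L ⟶ composite sys L')
    (t : composite sys L' ⟶ composite sys L'') :
    consWire sys e (s ≫ t) = consWire sys e s ≫ consWire sys e t :=
  whiskerLeft_comp _ _ _

theorem crossWires_naturality [BraidedCategory C] (e e' : E) {L L' : List E}
    (t : composite sys L ⟶ composite sys L') :
    crossWires sys e e' L ≫ consWire sys e' (consWire sys e t) =
      consWire sys e (consWire sys e' t) ≫ crossWires sys e e' L' :=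
  crossing_naturality _ _ t

theorem crossWires_yang_baxter [BraidedCategory C] (a b d : E) (L : List E) :
    crossWires sys a b (d :: L) ≫ consWire sys b (crossWires sys a d L) ≫
      crossWires sys b d (a :: L) =
      consWire sys a (crossWires sys b d L) ≫ crossWires sys a d (b :: L) ≫
        consWire sys d (crossWires sys a b L) :=
  crossing_yang_baxter _ _ _ _

variable [SymmetricCategory C]

theorem crossWires_crossWires (e e' : E) (L : List E) :
    crossWires sys e e' L ≫ crossWires sys e' e L = 𝟙 _ :=
  crossing_crossing _ _ _

namespace Rewiring

theorem refl : ∀ L : List E, Rewiring sys L L (𝟙 _)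
  | [] => .nil
  | e :: L => by
    have h := (refl L).cons e
    rwa [whiskerLeft_id] at h

theorem congr {L L' : List E} {σ σ' : composite sys L ⟶ composite sys L'}
    (h : Rewiring sys L L' σ) (e : σ' = σ) : Rewiring sys L L' σ' :=
  e ▸ h

theorem perm {L L' : List E} {σ : composite sys L ⟶ composite sys L'} (h : Rewiring sys L L' σ) :
    L.Perm L' := by
  induction h with
  | nil => exact .nil
  | cons e _ ih => exact ih.cons e
  | swap e e' L => exact .swap _ _ _
  | trans _ _ ih ih' => exact ih.trans ih'

theorem exists_of_perm {L L' : List E} (h : L.Perm L') :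
    ∃ σ : composite sys L ⟶ composite sys L', Rewiring sys L L' σ := by
  induction h with
  | nil => exact ⟨_, .nil⟩
  | cons e _ ih => exact ih.elim fun _ h => ⟨_, h.cons e⟩
  | swap e e' L => exact ⟨_, .swap _ _ _⟩
  | trans _ _ ih ih' => exact ih.elim fun _ h => ih'.elim fun _ h' => ⟨_, h.trans h'⟩

theorem exists_inverse {L L' : List E} {σ : composite sys L ⟶ composite sys L'}
    (h : Rewiring sys L L' σ) : ∃ τ, Rewiring sys L' L τ ∧ σ ≫ τ = 𝟙 _ := by
  induction h with
  | nil => exact ⟨_, .nil, by simp⟩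
  | cons e _ ih =>
    obtain ⟨τ, h, hτ⟩ := ih
    exact ⟨_, h.cons e, (consWire_comp e _ _).symm.trans (by rw [hτ, consWire_id])⟩
  | swap e e' L => exact ⟨_, .swap _ _ _, crossWires_crossWires e e' L⟩
  | trans _ _ ih ih' =>
    obtain ⟨τ, h, hτ⟩ := ih
    obtain ⟨τ', h', hτ'⟩ := ih'
    exact ⟨_, h'.trans h, by rw [Category.assoc, reassoc_of% hτ', hτ]⟩

end Rewiring

/-- `PullOut sys e L L₀ τ`: the morphism `τ` moves the first occurrence of the wire `e` in `L` to
the front, which leaves `L₀` behind. -/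
inductive PullOut (sys : E → C) (e : E) :
    ∀ L L₀ : List E, (composite sys L ⟶ composite sys (e :: L₀)) → Prop
  | head (L : List E) : PullOut sys e (e :: L) L (𝟙 _)
  | cons {f : E} (hf : f ≠ e) {L L₀ : List E} {τ : composite sys L ⟶ composite sys (e :: L₀)} :
      PullOut sys e L L₀ τ →
      PullOut sys e (f :: L) (f :: L₀) (consWire sys f τ ≫ crossWires sys f e L₀)

theorem PullOut.exists_of_mem {e : E} {L : List E} (h : e ∈ L) :
    ∃ L₀ τ, PullOut sys e L L₀ τ := by
  induction L with
  | nil => cases h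
  | cons f L ih =>
    by_cases hf : f = e
    · subst hf
      exact ⟨_, _, .head L⟩
    · obtain ⟨L₀, τ, hτ⟩ := ih ((List.mem_cons.1 h).resolve_left (Ne.symm hf))
      exact ⟨_, _, .cons hf hτ⟩

theorem PullOut.exists_crossWires_comp {e f f' : E} (hne : f ≠ f') {L L₀ : List E}
    {τ : composite sys (f :: f' :: L) ⟶ composite sys (e :: L₀)}
    (hτ : PullOut sys e (f :: f' :: L) L₀ τ) :
    ∃ L₀' τ' σ', PullOut sys e (f' :: f :: L) L₀' τ' ∧ Rewiring sys L₀ L₀' σ' ∧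
      crossWires sys f f' L ≫ τ' = τ ≫ consWire sys e σ' := by
  cases hτ with
  | head =>
    refine ⟨_, _, _, .cons hne.symm (.head _), .refl _, ?_⟩
    rw [consWire_id, consWire_id, Category.id_comp, Category.id_comp, crossWires_crossWires]
  | @cons _ hf _ L₀ τ hτ =>
    cases hτ with
    | head =>
      refine ⟨_, _, _, .head _, .refl _, ?_⟩
      rw [consWire_id, consWire_id, Category.id_comp]
    | @cons _ hf' _ L₀ τ hτ =>
      refine ⟨_, _, _, .cons hf' (.cons hf hτ), .swap f f' L₀, ?_⟩
      change _ = _ ≫ consWire sys e (crossWires sys f f' L₀)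
      simp only [consWire_comp, Category.assoc]
      rw [← crossWires_yang_baxter, ← Category.assoc, crossWires_naturality, Category.assoc]

theorem Rewiring.exists_comp_pullOut {e : E} {L L' : List E}
    {σ : composite sys L ⟶ composite sys L'} (h : Rewiring sys L L' σ) (hL : L.Nodup) {L₀ : List E}
    {τ : composite sys L ⟶ composite sys (e :: L₀)} (hτ : PullOut sys e L L₀ τ) :
    ∃ L₀' τ' σ', PullOut sys e L' L₀' τ' ∧ Rewiring sys L₀ L₀' σ' ∧
      σ ≫ τ' = τ ≫ consWire sys e σ' := by
  induction h generalizing L₀ with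
  | nil => cases hτ
  | @cons f L L' σ h ih =>
    cases hτ with
    | head => exact ⟨_, _, _, .head _, h, (Category.comp_id _).trans (Category.id_comp _).symm⟩
    | @cons _ hf _ L₀ τ hτ =>
      obtain ⟨L₀', τ', σ', hτ', hσ', hcomp⟩ := ih hL.of_cons hτ
      refine ⟨_, _, _, .cons hf hτ', hσ'.cons f, ?_⟩
      change consWire sys f σ ≫ _ = _ ≫ consWire sys e (consWire sys f σ')
      rw [← Category.assoc, ← consWire_comp, hcomp, consWire_comp, Category.assoc, Category.assoc,
        crossWires_naturality]
  | swap f f' L =>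
    have hne : f ≠ f' := fun h => (List.nodup_cons.1 hL).1 (h ▸ List.mem_cons_self)
    exact hτ.exists_crossWires_comp hne
  | trans h _ ih ih' =>
    obtain ⟨L₁, τ₁, σ₁, hτ₁, hσ₁, hcomp₁⟩ := ih hL hτ
    obtain ⟨L₂, τ₂, σ₂, hτ₂, hσ₂, hcomp₂⟩ := ih' (h.perm.nodup_iff.1 hL) hτ₁
    refine ⟨_, _, _, hτ₂, hσ₁.trans hσ₂, ?_⟩
    rw [consWire_comp, Category.assoc, hcomp₂, reassoc_of% hcomp₁]

theorem Rewiring.eq_eqToHom {L L' : List E} {σ : composite sys L ⟶ composite sys L'}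
    (h : Rewiring sys L L' σ) (hL : L = []) (hL' : L' = []) :
    σ = eqToHom (by rw [hL, hL']) := by
  induction h with
  | nil => rfl
  | cons => cases hL
  | swap => cases hL
  | trans h _ ih ih' =>
    have hM := List.nil_perm.1 (hL ▸ h.perm)
    rw [ih hL hM, ih' hM hL', eqToHom_trans]

theorem Rewiring.unique {L L' : List E} {σ ρ : composite sys L ⟶ composite sys L'}
    (hσ : Rewiring sys L L' σ) (hρ : Rewiring sys L L' ρ) (hL : L.Nodup) : σ = ρ := by
  induction L' generalizing L with
  | nil =>
    have hnil := List.perm_nil.1 hσ.perm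
    rw [hσ.eq_eqToHom hnil rfl, hρ.eq_eqToHom hnil rfl]
  | cons e L' ih =>
    obtain ⟨L₀, τ, hτ⟩ := PullOut.exists_of_mem (sys := sys) (hσ.perm.mem_iff.2 List.mem_cons_self)
    obtain ⟨_, _, σ', hσ₁, hσ', hσ_comp⟩ := hσ.exists_comp_pullOut hL hτ
    obtain ⟨_, _, ρ', hρ₁, hρ', hρ_comp⟩ := hρ.exists_comp_pullOut hL hτ
    cases hσ₁ with
    | cons hf => exact absurd rfl hf
    | head =>
      cases hρ₁ with
      | cons hf => exact absurd rfl hf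
      | head =>
        have hL₀ : L₀.Nodup := hσ'.perm.nodup_iff.2 (hσ.perm.nodup_iff.1 hL).of_cons
        rw [Category.comp_id] at hσ_comp hρ_comp
        rw [hσ_comp, hρ_comp, ih hσ' hρ' hL₀]

end Rewiring

/-! ### Blocks of wires -/

section Blocks

variable {C : Type (u + 1)} [LargeCategory C] [MonoidalCategory C] {E : Type w} {sys : E → C}

/-- A morphism between composites applied to the first wires of a longer list. -/
def applyFront {A B : List E} (h : composite sys A ⟶ composite sys B) (R : List E) :
    composite sys (A ++ R) ⟶ composite sys (B ++ R) :=
  (compositeAppend sys R A).hom ≫ h ▷ composite sys R ≫ (compositeAppend sys R B).inv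

/-- A morphism between composites applied behind the wires of `A`. -/
def applyBehind : ∀ (A : List E) {R R' : List E} (_ : composite sys R ⟶ composite sys R'),
    composite sys (A ++ R) ⟶ composite sys (A ++ R')
  | [], _, _, t => t
  | e :: A, _, _, t => consWire sys e (applyBehind A t)

theorem applyBehind_compositeAppend (A : List E) {R R' : List E}
    (t : composite sys R ⟶ composite sys R') :
    applyBehind A t ≫ (compositeAppend sys R' A).hom =
      (compositeAppend sys R A).hom ≫ composite sys A ◁ t := by
  induction A with
  | nil => exact (leftUnitor_inv_naturality t)
  | cons e A ih => exact whiskerLeft_comp_appendIso (sys e) ih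

theorem applyFront_applyBehind {A B : List E} (h : composite sys A ⟶ composite sys B)
    {R R' : List E} (t : composite sys R ⟶ composite sys R') :
    applyFront h R ≫ applyBehind B t = applyBehind A t ≫ applyFront h R' := by
  rw [← cancel_mono (compositeAppend sys R' B).hom]
  simp only [applyFront, Category.assoc, applyBehind_compositeAppend, Iso.inv_hom_id_assoc,
    Iso.inv_hom_id, Category.comp_id]
  rw [← whisker_exchange, ← Category.assoc (applyBehind A t), applyBehind_compositeAppend,
    Category.assoc]

/-- Two preparations side by side. -/
def juxtapose {L L' : List E} (r : 𝟙_ C ⟶ composite sys L) (s : 𝟙_ C ⟶ composite sys L') :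
    𝟙_ C ⟶ composite sys (L ++ L') :=
  (λ_ (𝟙_ C)).inv ≫ (r ⊗ₘ s) ≫ (compositeAppend sys L' L).inv

theorem juxtapose_comp {L L' L'' : List E} (r : 𝟙_ C ⟶ composite sys L)
    (s : 𝟙_ C ⟶ composite sys L') (t : composite sys L' ⟶ composite sys L'') :
    juxtapose r (s ≫ t) = juxtapose r s ≫ applyBehind L t := by
  rw [← cancel_mono (compositeAppend sys L'' L).hom]
  simp only [juxtapose, Category.assoc, applyBehind_compositeAppend, Iso.inv_hom_id_assoc,
    Iso.inv_hom_id, Category.comp_id]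
  rw [← id_tensorHom, tensorHom_comp_tensorHom, Category.comp_id]

theorem juxtapose_id_comp_rightUnitor {L : List E} (r : 𝟙_ C ⟶ composite sys L) :
    juxtapose r (𝟙 (composite sys [])) ≫
      (compositeAppend sys [] L).hom ≫ (ρ_ (composite sys L)).hom = r := by
  have unit_comp {A F : C} (r : 𝟙_ C ⟶ A) (c : F ≅ A ⊗ 𝟙_ C) :
      ((λ_ (𝟙_ C)).inv ≫ (r ⊗ₘ 𝟙 (𝟙_ C)) ≫ c.inv) ≫ c.hom ≫ (ρ_ A).hom = r := by
    simp only [Category.assoc, Iso.inv_hom_id_assoc]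
    rw [tensorHom_id, rightUnitor_naturality, ← unitors_equal, Iso.inv_hom_id_assoc]
  exact unit_comp r (compositeAppend sys [] L)

variable [SymmetricCategory C]

theorem Rewiring.applyBehind (A : List E) {R R' : List E} {t : composite sys R ⟶ composite sys R'}
    (h : Rewiring sys R R' t) : Rewiring sys (A ++ R) (A ++ R') (applyBehind A t) := by
  induction A with
  | nil => exact h
  | cons e A ih => exact ih.cons e

/-- The wire `e` moved behind the wires of `B`. -/
def moveWire (e : E) (B R : List E) :
    composite sys (e :: (B ++ R)) ⟶ composite sys (B ++ e :: R) :=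
  sys e ◁ (compositeAppend sys R B).hom ≫ crossing (sys e) (composite sys B) (composite sys R) ≫
    (compositeAppend sys (e :: R) B).inv

theorem Rewiring.moveWire (e : E) (B R : List E) :
    Rewiring sys (e :: (B ++ R)) (B ++ e :: R) (moveWire e B R) := by
  induction B with
  | nil =>
    exact (Rewiring.refl (e :: R)).congr (crossing_conj_unit (sys e) (composite sys R))
  | cons b B ih =>
    exact ((Rewiring.swap e b (B ++ R)).trans (ih.cons b)).congr
      (crossing_conj_appendIso (sys e) (sys b) (compositeAppend sys R B)
        (compositeAppend sys (e :: R) B))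

theorem moveWire_applyFront (e : E) {B B₁ : List E} (k : composite sys B ⟶ composite sys B₁)
    (R : List E) :
    moveWire e B R ≫ applyFront k (e :: R) = consWire sys e (applyFront k R) ≫ moveWire e B₁ R :=
  crossing_conj_naturality (sys e) k (compositeAppend sys R B) (compositeAppend sys R B₁)
    (compositeAppend sys (e :: R) B) (compositeAppend sys (e :: R) B₁)

/-- The wires of `A` moved behind those of `B`. -/
def moveBlock : ∀ A B R : List E, composite sys (A ++ (B ++ R)) ⟶ composite sys (B ++ (A ++ R))
  | [], _, _ => 𝟙 _
  | e :: A, B, R => consWire sys e (moveBlock A B R) ≫ moveWire e B (A ++ R)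

theorem Rewiring.moveBlock (A B R : List E) :
    Rewiring sys (A ++ (B ++ R)) (B ++ (A ++ R)) (moveBlock A B R) := by
  induction A with
  | nil => exact .refl _
  | cons e A ih => exact (ih.cons e).trans (.moveWire e B (A ++ R))

theorem moveBlock_applyFront (A : List E) {B B' : List E}
    (k : composite sys B ⟶ composite sys B') (R : List E) :
    moveBlock A B R ≫ applyFront k (A ++ R) =
      applyBehind A (applyFront k R) ≫ moveBlock A B' R := by
  induction A with
  | nil => simp [moveBlock, applyBehind]
  | cons e A ih =>
    change (consWire sys e (moveBlock A B R) ≫ moveWire e B (A ++ R)) ≫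
        applyFront k (e :: (A ++ R)) =
      consWire sys e (applyBehind A (applyFront k R)) ≫
        consWire sys e (moveBlock A B' R) ≫ moveWire e B' (A ++ R)
    rw [Category.assoc, moveWire_applyFront, ← Category.assoc, ← consWire_comp, ih, consWire_comp,
      Category.assoc]

theorem Rewiring.append_nil (L : List E) :
    Rewiring sys (L ++ []) L ((compositeAppend sys [] L).hom ≫ (ρ_ (composite sys L)).hom) := by
  induction L with
  | nil => exact Rewiring.nil.congr (by
    change (λ_ (𝟙_ C)).inv ≫ (ρ_ (𝟙_ C)).hom = 𝟙 _
    rw [← unitors_equal, Iso.inv_hom_id])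
  | cons e L ih =>
    exact (ih.cons e).congr (appendIso_comp_rightUnitor (sys e) (compositeAppend sys [] L))

theorem Rewiring.exists_eq_applyBehind {A R R' : List E}
    {σ : composite sys (A ++ R) ⟶ composite sys (A ++ R')} (h : Rewiring sys (A ++ R) (A ++ R') σ)
    (hnodup : (A ++ R).Nodup) : ∃ ρ, Rewiring sys R R' ρ ∧ σ = _root_.applyBehind A ρ := by
  obtain ⟨ρ, hρ⟩ := exists_of_perm (sys := sys) ((List.perm_append_left_iff A).1 h.perm)
  exact ⟨ρ, hρ, h.unique (hρ.applyBehind A) hnodup⟩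

theorem exists_perm_append_of_nodup_of_subset {α : Type*} {A R : List α} (hA : A.Nodup)
    (h : A ⊆ R) : ∃ R', R.Perm (A ++ R') := by
  classical
  exact ⟨R.diff A, (List.subperm_append_diff_self_of_count_le
    (List.subperm_ext_iff.1 (hA.subperm h))).symm⟩

theorem Rewiring.exists_eq_moveBlock {A B R R' : List E}
    {σ : composite sys (A ++ R) ⟶ composite sys (B ++ R')} (h : Rewiring sys (A ++ R) (B ++ R') σ)
    (hnodup : (A ++ R).Nodup) (hsub : A ⊆ R') :
    ∃ R'' ρ ρ', Rewiring sys R (B ++ R'') ρ ∧ Rewiring sys (A ++ R'') R' ρ' ∧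
      σ = _root_.applyBehind A ρ ≫ _root_.moveBlock A B R'' ≫ _root_.applyBehind B ρ' := by
  obtain ⟨R'', hR'⟩ := exists_perm_append_of_nodup_of_subset hnodup.of_append_left hsub
  have hR : R.Perm (B ++ R'') := by
    refine (List.perm_append_left_iff A).1 (h.perm.trans ((hR'.append_left B).trans ?_))
    rw [← List.append_assoc, ← List.append_assoc]
    exact List.perm_append_comm.append_right _
  obtain ⟨ρ, hρ⟩ := exists_of_perm (sys := sys) hR
  obtain ⟨ρ', hρ'⟩ := exists_of_perm (sys := sys) hR'.symm
  exact ⟨R'', ρ, ρ', hρ, hρ', h.unique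
    ((hρ.applyBehind A).trans ((Rewiring.moveBlock A B R'').trans (hρ'.applyBehind B))) hnodup⟩

end Blocks

/-! ### Tests and weights -/

namespace CausalOPT

variable {C : Type (u + 1)} [LargeCategory C] [MonoidalCategory C] [SymmetricCategory C]
  (T : CausalOPT C)

/-- A family of events that is a test up to a relabelling of the outcomes. -/
def IsTestUpTo {X : Type*} {A B : C} (t : X → (A ⟶ B)) : Prop :=
  ∃ (Y : Type) (_ : Finite Y) (φ : Y ≃ X), T.IsTest (fun y => t (φ y))

/-- A morphism that is the only member of a test, up to a relabelling of the outcome. -/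
def IsDeterministic {A B : C} (e : A ⟶ B) : Prop := T.IsTestUpTo (fun _ : Unit => e)

/-- A member of some test. -/
def IsEvent {A B : C} (r : A ⟶ B) : Prop :=
  ∃ (Y : Type) (_ : Finite Y) (t : Y → (A ⟶ B)), T.IsTest t ∧ ∃ y, t y = r

variable {T}

theorem IsTest.isTestUpTo {X : Type} [Finite X] {A B : C} {t : X → (A ⟶ B)} (ht : T.IsTest t) :
    T.IsTestUpTo t :=
  ⟨X, inferInstance, Equiv.refl X, ht⟩

namespace IsTestUpTo

variable {X Y : Type*} {A B D F : C}

theorem relabel {t : X → (A ⟶ B)} (ht : T.IsTestUpTo t) (φ : Y ≃ X) :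
    T.IsTestUpTo (fun y => t (φ y)) := by
  obtain ⟨Z, _, ψ, h⟩ := ht
  exact ⟨Z, inferInstance, ψ.trans φ.symm, by simpa using h⟩

theorem comp {s : X → (A ⟶ B)} {t : Y → (B ⟶ D)} (hs : T.IsTestUpTo s) (ht : T.IsTestUpTo t) :
    T.IsTestUpTo (fun p : X × Y => s p.1 ≫ t p.2) := by
  obtain ⟨Z, _, ψ, h⟩ := hs
  obtain ⟨Z', _, ψ', h'⟩ := ht
  exact ⟨Z × Z', inferInstance, ψ.prodCongr ψ', T.isTest_comp _ _ h h'⟩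

theorem tensor {s : X → (A ⟶ B)} {t : Y → (D ⟶ F)} (hs : T.IsTestUpTo s) (ht : T.IsTestUpTo t) :
    T.IsTestUpTo (fun p : X × Y => s p.1 ⊗ₘ t p.2) := by
  obtain ⟨Z, _, ψ, h⟩ := hs
  obtain ⟨Z', _, ψ', h'⟩ := ht
  exact ⟨Z × Z', inferInstance, ψ.prodCongr ψ', T.isTest_tensor _ _ h h'⟩

theorem comp_deterministic {s : X → (A ⟶ B)} {e : B ⟶ D} (hs : T.IsTestUpTo s)
    (he : T.IsDeterministic e) : T.IsTestUpTo (fun x => s x ≫ e) :=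
  (hs.comp he).relabel (Equiv.prodPUnit X).symm

theorem deterministic_comp {s : X → (B ⟶ D)} {e : A ⟶ B} (he : T.IsDeterministic e)
    (hs : T.IsTestUpTo s) : T.IsTestUpTo (fun x => e ≫ s x) :=
  (IsTestUpTo.comp he hs).relabel (Equiv.punitProd X).symm

theorem isEvent {t : X → (A ⟶ B)} (ht : T.IsTestUpTo t) (x : X) : T.IsEvent (t x) := by
  obtain ⟨Z, _, ψ, h⟩ := ht
  exact ⟨Z, inferInstance, _, h, ψ.symm x, by simp⟩

end IsTestUpTo

theorem isDeterministic_id (A : C) : T.IsDeterministic (𝟙 A) := (T.isTest_id A).isTestUpTo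

namespace IsDeterministic

variable {A B D F : C}

theorem isEvent {e : A ⟶ B} (he : T.IsDeterministic e) : T.IsEvent e := IsTestUpTo.isEvent he ()

theorem comp {e : A ⟶ B} {e' : B ⟶ D} (he : T.IsDeterministic e) (he' : T.IsDeterministic e') :
    T.IsDeterministic (e ≫ e') :=
  IsTestUpTo.comp_deterministic he he'

theorem tensor {e : A ⟶ B} {e' : D ⟶ F} (he : T.IsDeterministic e) (he' : T.IsDeterministic e') :
    T.IsDeterministic (e ⊗ₘ e') :=
  (IsTestUpTo.tensor he he').relabel (Equiv.prodPUnit Unit).symm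

theorem whiskerLeft {e : A ⟶ B} (he : T.IsDeterministic e) (D : C) :
    T.IsDeterministic (D ◁ e) := by
  simpa using (isDeterministic_id D).tensor he

theorem whiskerRight {e : A ⟶ B} (he : T.IsDeterministic e) (D : C) :
    T.IsDeterministic (e ▷ D) := by
  simpa using he.tensor (isDeterministic_id D)

end IsDeterministic

theorem IsTestUpTo.whiskerRight {X : Type*} {A B : C} {t : X → (A ⟶ B)} (ht : T.IsTestUpTo t)
    (D : C) : T.IsTestUpTo (fun x => t x ▷ D) := by
  simpa using (ht.tensor (isDeterministic_id D)).relabel (Equiv.prodPUnit X).symm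

theorem IsEvent.comp {A B D : C} {r : A ⟶ B} {s : B ⟶ D} (hr : T.IsEvent r) (hs : T.IsEvent s) :
    T.IsEvent (r ≫ s) := by
  obtain ⟨X, _, t, ht, x, rfl⟩ := hr
  obtain ⟨Y, _, t', ht', y, rfl⟩ := hs
  exact ⟨X × Y, inferInstance, _, T.isTest_comp _ _ ht ht', (x, y), rfl⟩

theorem IsEvent.tensor {A B D F : C} {r : A ⟶ B} {s : D ⟶ F} (hr : T.IsEvent r)
    (hs : T.IsEvent s) : T.IsEvent (r ⊗ₘ s) := by
  obtain ⟨X, _, t, ht, x, rfl⟩ := hr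
  obtain ⟨Y, _, t', ht', y, rfl⟩ := hs
  exact ⟨X × Y, inferInstance, _, T.isTest_tensor _ _ ht ht', (x, y), rfl⟩

theorem IsEvent.prob_comp {r s : 𝟙_ C ⟶ 𝟙_ C} (hr : T.IsEvent r) (hs : T.IsEvent s) :
    T.prob (r ≫ s) = T.prob r * T.prob s := by
  obtain ⟨X, _, t, ht, x, rfl⟩ := hr
  obtain ⟨Y, _, t', ht', y, rfl⟩ := hs
  exact T.prob_comp t t' ht ht' x y

section Wires

variable {E : Type w} {sys : E → C}

theorem isDeterministic_compositeAppend_hom (R L : List E) :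
    T.IsDeterministic (compositeAppend sys R L).hom := by
  induction L with
  | nil => exact (T.isTest_leftUnitor_inv _).isTestUpTo
  | cons e L ih =>
    exact (ih.whiskerLeft (sys e)).comp (T.isTest_associator_inv _ _ _).isTestUpTo

theorem isDeterministic_compositeAppend_inv (R L : List E) :
    T.IsDeterministic (compositeAppend sys R L).inv := by
  induction L with
  | nil => exact (T.isTest_leftUnitor_hom _).isTestUpTo
  | cons e L ih =>
    exact IsDeterministic.comp (T.isTest_associator_hom _ _ _).isTestUpTo
      (ih.whiskerLeft (sys e))

theorem _root_.Rewiring.isDeterministic {L L' : List E} {σ : composite sys L ⟶ composite sys L'}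
    (h : Rewiring sys L L' σ) : T.IsDeterministic σ := by
  induction h with
  | nil => exact isDeterministic_id _
  | cons e _ ih => exact ih.whiskerLeft _
  | swap e e' L =>
    exact IsDeterministic.comp (T.isTest_associator_inv _ _ _).isTestUpTo
      (IsDeterministic.comp
        (IsDeterministic.whiskerRight (T.isTest_braiding _ _).isTestUpTo _)
        (T.isTest_associator_hom _ _ _).isTestUpTo)
  | trans _ _ ih ih' => exact ih.comp ih'

theorem IsTestUpTo.applyFront {X : Type*} {A B : List E}
    {t : X → (composite sys A ⟶ composite sys B)} (ht : T.IsTestUpTo t) (R : List E) :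
    T.IsTestUpTo (fun x => applyFront (t x) R) :=
  .deterministic_comp (isDeterministic_compositeAppend_hom R A)
    ((ht.whiskerRight _).comp_deterministic (isDeterministic_compositeAppend_inv R B))

end Wires

variable (T)

/-- A deterministic effect, the `⊤` of the system. -/
noncomputable def discard (A : C) : A ⟶ 𝟙_ C := (T.exists_deterministic A).choose

/-- The probability of a preparation-event whose output is discarded. -/
noncomputable def weight {A : C} (r : 𝟙_ C ⟶ A) : ℝ := T.prob (r ≫ T.discard A)

variable {T}

theorem isDeterministic_discard (A : C) : T.IsDeterministic (T.discard A) :=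
  (T.exists_deterministic A).choose_spec.isTestUpTo

theorem IsEvent.sum_prob {X : Type*} [Fintype X] {A : C} {r : 𝟙_ C ⟶ A} (hr : T.IsEvent r)
    {a : X → (A ⟶ 𝟙_ C)} (ha : T.IsTestUpTo a) : ∑ x, T.prob (r ≫ a x) = T.weight r := by
  obtain ⟨Y, _, t, ht, y, rfl⟩ := hr
  obtain ⟨Z, _, φ, h⟩ := ha
  have := Fintype.ofFinite Z
  rw [← φ.sum_comp]
  exact T.deterministic_unique _ _ t h (T.exists_deterministic A).choose_spec ht y

theorem IsEvent.prob_deterministic {A : C} {r : 𝟙_ C ⟶ A} (hr : T.IsEvent r) {e : A ⟶ 𝟙_ C}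
    (he : T.IsDeterministic e) : T.prob (r ≫ e) = T.weight r := by
  simpa using hr.sum_prob he

theorem IsEvent.sum_weight {X : Type*} [Fintype X] {A B : C} {r : 𝟙_ C ⟶ A} (hr : T.IsEvent r)
    {t : X → (A ⟶ B)} (ht : T.IsTestUpTo t) : ∑ x, T.weight (r ≫ t x) = T.weight r := by
  simpa [weight] using hr.sum_prob (ht.comp_deterministic (isDeterministic_discard B))

theorem IsEvent.weight_deterministic {A B : C} {r : 𝟙_ C ⟶ A} (hr : T.IsEvent r) {e : A ⟶ B}
    (he : T.IsDeterministic e) : T.weight (r ≫ e) = T.weight r := by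
  simpa using hr.sum_weight he

theorem IsEvent.weight_eq_prob {r : 𝟙_ C ⟶ 𝟙_ C} (hr : T.IsEvent r) :
    T.weight r = T.prob r := by
  simpa using (hr.prob_deterministic (isDeterministic_id _)).symm

theorem IsEvent.weight_juxtapose {E : Type w} {sys : E → C} {L L' : List E}
    {r : 𝟙_ C ⟶ composite sys L} {s : 𝟙_ C ⟶ composite sys L'} (hr : T.IsEvent r)
    (hs : T.IsEvent s) : T.weight (juxtapose r s) = T.weight r * T.weight s := by
  have hunit : T.IsEvent (λ_ (𝟙_ C)).inv :=
    (T.isTest_leftUnitor_inv _).isTestUpTo.isEvent ()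
  have hevent : T.IsEvent (juxtapose r s) :=
    hunit.comp ((hr.tensor hs).comp (isDeterministic_compositeAppend_inv L' L).isEvent)
  have hdiscard : T.IsDeterministic ((compositeAppend sys L' L).hom ≫
      (T.discard _ ⊗ₘ T.discard _) ≫ (λ_ (𝟙_ C)).hom) :=
    (isDeterministic_compositeAppend_hom L' L).comp
      (((isDeterministic_discard _).tensor (isDeterministic_discard _)).comp
        (T.isTest_leftUnitor_hom _).isTestUpTo)
  calc T.weight (juxtapose r s)
      = T.prob (juxtapose r s ≫ (compositeAppend sys L' L).hom ≫
          (T.discard _ ⊗ₘ T.discard _) ≫ (λ_ (𝟙_ C)).hom) :=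
        (hevent.prob_deterministic hdiscard).symm
    _ = T.prob ((r ≫ T.discard _) ≫ s ≫ T.discard _) := by
        rw [← leftUnitor_inv_comp_tensorHom_comp_leftUnitor_hom]
        simp only [juxtapose, Category.assoc, Iso.inv_hom_id_assoc, tensorHom_comp_tensorHom_assoc]
    _ = T.weight r * T.weight s :=
        (hr.comp (isDeterministic_discard _).isEvent).prob_comp
          (hs.comp (isDeterministic_discard _).isEvent)

end CausalOPT

/-! ### Directed acyclic graphs -/

namespace GDAG

variable {V : Type w} (G : GDAG V)

theorem ne_of_edge {a b : V} (h : G.edge a b) : a ≠ b := fun hab =>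
  G.acyclic b (.single (hab ▸ h))

variable [Finite V]

theorem mem_inWires {v : V} {e : G.UEdge} : e ∈ G.inWires v ↔ e.1.2 = v := by
  simp [inWires]

theorem mem_outWires {v : V} {e : G.UEdge} : e ∈ G.outWires v ↔ e.1.1 = v := by
  simp [outWires]

theorem nodup_inWires (v : V) : (G.inWires v).Nodup := Finset.nodup_toList _

theorem nodup_outWires (v : V) : (G.outWires v).Nodup := Finset.nodup_toList _

theorem exists_minimal {S : Set V} (hS : S.Nonempty) : ∃ v ∈ S, ∀ a ∈ S, ¬ G.edge a v := by
  have : Std.Irrefl (Relation.TransGen G.edge) := ⟨G.acyclic⟩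
  obtain ⟨v, hv, hmin⟩ :=
    (Finite.wellFounded_of_trans_of_irrefl (Relation.TransGen G.edge)).has_min S hS
  exact ⟨v, hv, fun a ha hav => hmin a ha (.single hav)⟩

theorem exists_maximal {S : Set V} (hS : S.Nonempty) : ∃ v ∈ S, ∀ a ∈ S, ¬ G.edge v a :=
  exists_minimal ⟨fun a b => G.edge b a,
    fun v h => G.acyclic v (Relation.transGen_swap.1 h), G.observed⟩ hS

theorem topological_induction [DecidableEq V] {r : V → V → Prop} (hr : ∀ a v, r a v → G.edge a v)
    {p : Finset V → Prop} (empty : p ∅)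
    (insert : ∀ v S, v ∉ S → (∀ a, r a v → a ∈ S) → p S → p (insert v S)) {S : Finset V}
    (hS : ∀ a v, r a v → v ∈ S → a ∈ S) : p S := by
  induction S using Finset.strongInduction with
  | H S ih =>
    rcases S.eq_empty_or_nonempty with rfl | hne
    · exact empty
    obtain ⟨v, hv, hmax⟩ := G.exists_maximal (Finset.coe_nonempty.2 hne)
    have hpar : ∀ a w, r a w → w ∈ S → a ∈ S.erase v := fun a w haw hw =>
      Finset.mem_erase.2 ⟨fun h => hmax w hw (h ▸ hr a w haw), hS a w haw hw⟩
    rw [← Finset.insert_erase hv]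
    exact insert v _ (Finset.notMem_erase v S) (fun a hav => hpar a v hav hv)
      (ih _ (Finset.erase_ssubset hv) fun a w haw hw => hpar a w haw (Finset.mem_of_mem_erase hw))

end GDAG

/-! ### Circuits of some of the nodes -/

namespace CircuitModel

variable {C : Type (u + 1)} [LargeCategory C] [MonoidalCategory C] [SymmetricCategory C]
  {T : CausalOPT C}

theorem isTestUpTo_test {V : Type w} [Finite V] {G : GDAG V} {Ω : G.observed → Type}
    [∀ i, Finite (Ω i)] (M : CircuitModel T G Ω) (v : V) (c : G.ParentValue Ω v) :
    T.IsTestUpTo (M.test v c) :=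
  have : Finite (G.Outcome Ω v) := inferInstance
  (M.isTest v c).isTestUpTo

variable {V : Type w} [Fintype V] {G : GDAG V} {Ω : G.observed → Type} [∀ i, Finite (Ω i)]
  (M : CircuitModel T G Ω)

theorem event_congr {x x' : ∀ i, Ω i} {v : V}
    (hx : ∀ i : G.observed, (i : V) = v ∨ G.edge i v → x i = x' i) :
    M.event x v = M.event x' v := by
  have hpar : (fun j => x j.1 : G.ParentValue Ω v) =
      fun j : {j : G.observed // G.edge j v} => x' j.1 :=
    funext fun j => hx _ (.inr j.2)
  have hout : (fun h => x ⟨v, h⟩ : G.Outcome Ω v) = fun h => x' ⟨v, h⟩ :=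
    funext fun _ => hx _ (.inl rfl)
  rw [event, event, hpar, hout]

variable [DecidableEq V]

/-- Circuits of the events of some of the nodes. Unlike for `Partial`, observed parents of a node
need not be part of the circuit. -/
inductive Subcircuit : Finset V → ∀ L : List G.UEdge,
    ((∀ i, Ω i) → (𝟙_ C ⟶ composite M.sys L)) → Prop
  | empty : Subcircuit ∅ [] (fun _ => 𝟙 _)
  | rewire {S : Finset V} {L L' : List G.UEdge} {f : (∀ i, Ω i) → (𝟙_ C ⟶ composite M.sys L)}
      {σ : composite M.sys L ⟶ composite M.sys L'} :
      Subcircuit S L f → Rewiring M.sys L L' σ → Subcircuit S L' (fun x => f x ≫ σ)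
  | node {S : Finset V} (v : V) {R : List G.UEdge}
      {f : (∀ i, Ω i) → (𝟙_ C ⟶ composite M.sys (G.inWires v ++ R))} :
      v ∉ S → Subcircuit S (G.inWires v ++ R) f →
      Subcircuit (insert v S) (G.outWires v ++ R) (fun x => f x ≫ applyFront (M.event x v) R)

variable {M} {S : Finset V} {L : List G.UEdge} {f : (∀ i, Ω i) → (𝟙_ C ⟶ composite M.sys L)}

theorem Partial.subcircuit (h : M.Partial S L f) : M.Subcircuit S L f := by
  induction h with
  | empty => exact .empty
  | rewire _ hσ ih => exact ih.rewire hσ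
  | node v hv _ _ ih => exact ih.node v hv

theorem Partial.edge_mem (h : M.Partial S L f) {a v : V} (hav : G.edge a v) (hv : v ∈ S) :
    a ∈ S := by
  induction h with
  | empty => cases hv
  | rewire _ _ ih => exact ih hv
  | node w _ hpar _ ih =>
    rcases Finset.mem_insert.1 hv with rfl | hv
    · exact Finset.mem_insert_of_mem (hpar a hav)
    · exact Finset.mem_insert_of_mem (ih hv)

namespace Subcircuit

theorem nodup_and_mem_iff (h : M.Subcircuit S L f) :
    (∀ e : G.UEdge, e.1.2 ∈ S → e.1.1 ∈ S) ∧ L.Nodup ∧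
      ∀ e : G.UEdge, e ∈ L ↔ e.1.1 ∈ S ∧ e.1.2 ∉ S := by
  induction h with
  | empty => simp
  | rewire _ hσ ih =>
    obtain ⟨hclosed, hnodup, hmem⟩ := ih
    exact ⟨hclosed, hσ.perm.nodup_iff.1 hnodup, fun e => hσ.perm.mem_iff.symm.trans (hmem e)⟩
  | @node S v R _ hv _ ih =>
    obtain ⟨hclosed, hnodup, hmem⟩ := ih
    obtain ⟨-, hR, hdisj⟩ := List.nodup_append'.1 hnodup
    have hmemR (e : G.UEdge) : e ∈ R ↔ (e.1.1 ∈ S ∧ e.1.2 ∉ S) ∧ e.1.2 ≠ v := by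
      rw [← hmem, List.mem_append, G.mem_inWires]
      exact ⟨fun he => ⟨.inr he, fun hev => hdisj (G.mem_inWires.2 hev) he⟩,
        fun he => he.1.resolve_left he.2⟩
    have hsource (e : G.UEdge) (he : e.1.2 = v) : e.1.1 ∈ S :=
      ((hmem e).1 (List.mem_append_left R (G.mem_inWires.2 he))).1
    have hout (e : G.UEdge) (he : e.1.1 = v) : e.1.2 ∉ S ∧ e.1.2 ≠ v :=
      ⟨fun h => hv (he ▸ hclosed e h), fun h => hv (he ▸ hsource e h)⟩
    refine ⟨fun e he => ?_, List.nodup_append'.2 ⟨G.nodup_outWires v, hR, fun e he he' => ?_⟩,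
      fun e => ?_⟩
    · exact Finset.mem_insert_of_mem ((Finset.mem_insert.1 he).elim (hsource e) (hclosed e))
    · exact hv (G.mem_outWires.1 he ▸ ((hmemR e).1 he').1.1)
    · rw [List.mem_append, G.mem_outWires, hmemR]
      grind

theorem nodup (h : M.Subcircuit S L f) : L.Nodup := h.nodup_and_mem_iff.2.1

theorem mem_iff (h : M.Subcircuit S L f) {e : G.UEdge} : e ∈ L ↔ e.1.1 ∈ S ∧ e.1.2 ∉ S :=
  h.nodup_and_mem_iff.2.2 e

theorem isEvent (h : M.Subcircuit S L f) (x : ∀ i, Ω i) : T.IsEvent (f x) := by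
  induction h with
  | empty => exact (CausalOPT.isDeterministic_id _).isEvent
  | rewire _ hσ ih => exact ih.comp hσ.isDeterministic.isEvent
  | @node _ v R _ _ _ ih =>
    exact ih.comp (((M.isTestUpTo_test v _).applyFront R).isEvent fun h => x ⟨v, h⟩)

theorem congr (h : M.Subcircuit S L f) {x x' : ∀ i, Ω i}
    (hx : ∀ i : G.observed, (∃ v ∈ S, (i : V) = v ∨ G.edge i v) → x i = x' i) : f x = f x' := by
  induction h with
  | empty => rfl
  | rewire _ _ ih => simp only [ih hx]
  | @node S v R _ _ _ ih =>
    simp only [M.event_congr fun i hi => hx i ⟨v, Finset.mem_insert_self v S, hi⟩,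
      ih fun i ⟨a, ha, hi⟩ => hx i ⟨a, Finset.mem_insert_of_mem ha, hi⟩]

theorem applyBehind_node {v : V} {A R : List G.UEdge}
    {g : (∀ i, Ω i) → (𝟙_ C ⟶ composite M.sys (A ++ (G.inWires v ++ R)))}
    (h : M.Subcircuit S (A ++ (G.inWires v ++ R)) g) (hv : v ∉ S) :
    M.Subcircuit (insert v S) (A ++ (G.outWires v ++ R))
      (fun x => g x ≫ applyBehind A (applyFront (M.event x v) R)) := by
  obtain ⟨τ, hτ, hinv⟩ :=
    (Rewiring.moveBlock (sys := M.sys) A (G.outWires v) R).exists_inverse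
  have hnode := ((h.rewire (.moveBlock A (G.inWires v) R)).node v hv).rewire hτ
  convert hnode using 2 with x
  rw [Category.assoc, Category.assoc, ← Category.assoc (moveBlock _ _ _), moveBlock_applyFront,
    Category.assoc, hinv, Category.comp_id]

theorem exists_node_last (h : M.Subcircuit S L f) {v : V} (hv : v ∈ S)
    (hmax : ∀ e : G.UEdge, e.1.1 = v → e.1.2 ∉ S) :
    ∃ R g σ, M.Subcircuit (S.erase v) (G.inWires v ++ R) g ∧
      Rewiring M.sys (G.outWires v ++ R) L σ ∧
      ∀ x, f x = g x ≫ applyFront (M.event x v) R ≫ σ := by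
  induction h with
  | empty => simp at hv
  | rewire _ hσ ih =>
    obtain ⟨R, g, τ, hg, hτ, hf⟩ := ih hv hmax
    exact ⟨R, g, _, hg, hτ.trans hσ, fun x => by simp [hf]⟩
  | @node S w R f hw hS ih =>
    rcases eq_or_ne v w with rfl | hvw
    · exact ⟨R, f, _, by rwa [Finset.erase_insert hw], .refl _, fun x => by simp⟩
    have hvS : v ∈ S := (Finset.mem_insert.1 hv).resolve_left hvw
    obtain ⟨R₁, g, σ, hg, hσ, hf⟩ := ih hvS fun e he h => hmax e he (Finset.mem_insert_of_mem h)
    -- No outgoing wire of `v` enters `w`, so the events of `v` and `w` can be exchanged.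
    have hsub : G.outWires v ⊆ R := fun e he => by
      rw [G.mem_outWires] at he
      have hend := hmax e he
      rw [Finset.mem_insert, not_or] at hend
      have hopen := hS.mem_iff.2 ⟨he ▸ hvS, hend.2⟩
      rw [List.mem_append, G.mem_inWires] at hopen
      exact hopen.resolve_left hend.1
    obtain ⟨R₂, ρ, ρ', hρ, hρ', rfl⟩ :=
      hσ.exists_eq_moveBlock (hσ.perm.nodup_iff.2 hS.nodup) hsub
    have hgw := (hg.rewire (hρ.applyBehind (G.inWires v))).applyBehind_node
      fun h => hw (Finset.mem_of_mem_erase h)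
    rw [← Finset.erase_insert_of_ne hvw.symm] at hgw
    refine ⟨G.outWires w ++ R₂, _, moveBlock (G.outWires v) (G.outWires w) R₂ ≫
      applyBehind (G.outWires w) ρ', hgw,
      (Rewiring.moveBlock _ _ _).trans (hρ'.applyBehind _), fun x => ?_⟩
    have hv_ρ := applyFront_applyBehind (M.event x v) ρ
    have hv_w := applyFront_applyBehind (M.event x v) (applyFront (M.event x w) R₂)
    have hw_ρ' := applyFront_applyBehind (M.event x w) ρ'
    have hmove := moveBlock_applyFront (G.outWires v) (M.event x w) R₂
    simp only [hf, Category.assoc, ← hw_ρ', reassoc_of% hmove, reassoc_of% hv_ρ, reassoc_of% hv_w]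

theorem exists_rewiring_of_eq_empty (h : M.Subcircuit S L f) (hS : S = ∅) :
    ∃ σ, Rewiring M.sys [] L σ ∧ ∀ x, f x = σ := by
  induction h with
  | empty => exact ⟨_, .nil, fun _ => rfl⟩
  | rewire _ hσ ih =>
    obtain ⟨τ, hτ, hf⟩ := ih hS
    exact ⟨_, hτ.trans hσ, fun x => congrArg (· ≫ _) (hf x)⟩
  | node v => exact absurd hS (Finset.insert_ne_empty v _)

theorem exists_rewiring (h : M.Subcircuit S L f) {L' : List G.UEdge}
    {f' : (∀ i, Ω i) → (𝟙_ C ⟶ composite M.sys L')} (h' : M.Subcircuit S L' f') :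
    ∃ σ, Rewiring M.sys L L' σ ∧ ∀ x, f' x = f x ≫ σ := by
  induction h generalizing L' f' with
  | empty =>
    obtain ⟨σ, hσ, hf'⟩ := h'.exists_rewiring_of_eq_empty rfl
    exact ⟨σ, hσ, fun x => (hf' x).trans (Category.id_comp σ).symm⟩
  | rewire _ hσ ih =>
    obtain ⟨τ, hτ, hf'⟩ := ih h'
    obtain ⟨σ', hσ', hinv⟩ := hσ.exists_inverse
    exact ⟨_, hσ'.trans hτ, fun x => by rw [Category.assoc, reassoc_of% hinv, hf']⟩
  | @node S v R f hv hS ih =>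
    have hmax (e : G.UEdge) (he : e.1.1 = v) : e.1.2 ∉ insert v S :=
      ((hS.node v hv).mem_iff.1 (List.mem_append_left R (G.mem_outWires.2 he))).2
    obtain ⟨R', g, τ, hg, hτ, hf'⟩ := h'.exists_node_last (Finset.mem_insert_self v S) hmax
    rw [Finset.erase_insert hv] at hg
    obtain ⟨σ, hσ, hgf⟩ := ih hg
    obtain ⟨ρ, hρ, rfl⟩ := hσ.exists_eq_applyBehind hS.nodup
    have hcomm (x : ∀ i, Ω i) := applyFront_applyBehind (M.event x v) ρ
    exact ⟨_, (hρ.applyBehind _).trans hτ, fun x => by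
      simp only [hf', hgf, Category.assoc, reassoc_of% hcomm x]⟩

theorem juxtapose {S₁ S₂ : Finset V} {L₁ L₂ : List G.UEdge}
    {f₁ : (∀ i, Ω i) → (𝟙_ C ⟶ composite M.sys L₁)}
    {f₂ : (∀ i, Ω i) → (𝟙_ C ⟶ composite M.sys L₂)} (h₁ : M.Subcircuit S₁ L₁ f₁)
    (h₂ : M.Subcircuit S₂ L₂ f₂) (hdisj : Disjoint S₁ S₂) :
    M.Subcircuit (S₁ ∪ S₂) (L₁ ++ L₂) (fun x => _root_.juxtapose (f₁ x) (f₂ x)) := by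
  induction h₂ with
  | empty =>
    obtain ⟨τ, hτ, hinv⟩ := (Rewiring.append_nil (sys := M.sys) L₁).exists_inverse
    have h := h₁.rewire hτ
    rw [← Finset.union_empty S₁] at h
    convert h using 2 with x
    rw [← juxtapose_id_comp_rightUnitor (f₁ x), Category.assoc, hinv, Category.comp_id,
      juxtapose_id_comp_rightUnitor]
    rfl
  | rewire _ hσ ih =>
    simp only [juxtapose_comp]
    exact (ih hdisj).rewire (hσ.applyBehind L₁)
  | @node S v R f hv _ ih =>
    rw [Finset.disjoint_insert_right] at hdisj
    simp only [juxtapose_comp, Finset.union_insert]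
    exact (ih hdisj.2).applyBehind_node (by simp [hdisj.1, hv])

theorem exists_rewiring_inWires (h : M.Subcircuit S L f) {v : V} (hv : v ∉ S)
    (hpar : ∀ e : G.UEdge, e.1.2 = v → e.1.1 ∈ S) :
    ∃ R σ, Rewiring M.sys L (G.inWires v ++ R) σ := by
  obtain ⟨R, hR⟩ := exists_perm_append_of_nodup_of_subset (G.nodup_inWires v) (R := L)
    fun e he => by
      rw [G.mem_inWires] at he
      exact h.mem_iff.2 ⟨hpar e he, he ▸ hv⟩
  exact ⟨R, Rewiring.exists_of_perm hR⟩

end Subcircuit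

variable (M)

theorem exists_subcircuit (hS : ∀ e : G.UEdge, e.1.2 ∈ S → e.1.1 ∈ S) :
    ∃ L f, M.Subcircuit S L f := by
  refine G.topological_induction (r := fun a v => G.edge a v ∧ a ∉ G.observed)
    (p := fun S => ∃ L f, M.Subcircuit S L f) (fun _ _ h => h.1) ⟨[], _, .empty⟩ ?_
    fun a v h => hS ⟨(a, v), h⟩
  rintro v S hv hpar ⟨L, f, h⟩
  obtain ⟨R, σ, hσ⟩ := h.exists_rewiring_inWires hv fun e he => hpar _ (he ▸ e.2)
  exact ⟨_, _, (h.rewire hσ).node v hv⟩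

theorem exists_partial_univ : ∃ f, M.Partial Finset.univ [] f := by
  obtain ⟨L, f, h⟩ : ∃ L f, M.Partial Finset.univ L f := by
    refine G.topological_induction (p := fun S => ∃ L f, M.Partial S L f) (fun _ _ => id)
      ⟨[], _, .empty⟩ ?_ (fun _ _ _ _ => Finset.mem_univ _)
    rintro v S hv hpar ⟨L, f, h⟩
    obtain ⟨R, σ, hσ⟩ := h.subcircuit.exists_rewiring_inWires hv fun e he =>
      hpar _ (he ▸ e.2.1)
    exact ⟨_, _, (h.rewire hσ).node v hv hpar⟩
  obtain rfl : L = [] := List.eq_nil_iff_forall_not_mem.2 fun e he =>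
    (h.subcircuit.mem_iff.1 he).2 (Finset.mem_univ _)
  exact ⟨f, h⟩

end CircuitModel

/-! ### Marginals -/

section Marginal

variable {V : Type w} {O : Finset V} {Ω : O → Type}

open Classical in
/-- The values `a`, except that the variable at `v`, if there is one, takes the value `o`. -/
noncomputable def updateAt (a : ∀ i, Ω i) (v : V) (o : ∀ h : v ∈ O, Ω ⟨v, h⟩) : ∀ i, Ω i :=
  if h : v ∈ O then Function.update a ⟨v, h⟩ (o h) else a

theorem updateAt_self (a : ∀ i, Ω i) (v : V) (o : ∀ h : v ∈ O, Ω ⟨v, h⟩) (h : v ∈ O) :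
    updateAt a v o ⟨v, h⟩ = o h := by
  simp [updateAt, h]

theorem updateAt_of_ne (a : ∀ i, Ω i) {v : V} (o : ∀ h : v ∈ O, Ω ⟨v, h⟩) {i : O}
    (hi : (i : V) ≠ v) : updateAt a v o i = a i := by
  have hne (h : v ∈ O) : i ≠ ⟨v, h⟩ := fun h' => hi (congrArg Subtype.val h')
  by_cases h : v ∈ O <;> simp [updateAt, h, hne]

variable [DecidableEq V] [∀ i, Fintype (Ω i)] (P : (∀ i, Ω i) → ℝ)

theorem marginal_univ (a : ∀ i, Ω i) : marginal P Set.univ a = P a := by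
  classical
  rw [marginal, Finset.sum_filter, Finset.sum_eq_single a (by grind) (by simp)]
  simp

theorem sum_marginal_insert {S : Set V} {v : V} (hv : v ∉ S) (a : ∀ i, Ω i)
    [Fintype (∀ h : v ∈ O, Ω ⟨v, h⟩)] :
    ∑ o, marginal P (insert v S) (updateAt a v o) = marginal P S a := by
  classical
  rw [marginal, ← Finset.sum_fiberwise _ (fun (x : ∀ i, Ω i) (h : v ∈ O) => x ⟨v, h⟩)]
  refine Finset.sum_congr rfl fun o _ => Finset.sum_congr ?_ fun _ _ => rfl
  ext x
  simp only [Finset.mem_filter, Finset.mem_univ, true_and]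
  constructor
  · exact fun h => ⟨fun i hi => (h i (.inr hi)).trans (updateAt_of_ne a o fun hiv => hv (hiv ▸ hi)),
      funext fun hvO => (h ⟨v, hvO⟩ (.inl rfl)).trans (updateAt_self a v o hvO)⟩
  · rintro ⟨h, rfl⟩ ⟨i, hiO⟩ hi
    by_cases hiv : i = v
    · subst hiv
      exact (updateAt_self a i (fun h => x ⟨i, h⟩) hiO).symm
    · rw [updateAt_of_ne a _ hiv]
      exact h _ (hi.resolve_left hiv)

theorem marginal_marginal {S S' : Set V} (hS : S ∪ S' = Set.univ) :
    marginal (marginal P S) S' = marginal P (S ∩ S') := by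
  classical
  have hmem (v : V) (hv : v ∉ S) : v ∈ S' := (hS.symm ▸ Set.mem_univ v : v ∈ S ∪ S').resolve_left hv
  funext a
  simp only [marginal]
  refine (Finset.sum_comm' (s' := fun y => {fun i : O => if (i : V) ∈ S then y i else a i})
    fun x y => ?_).trans (Finset.sum_congr rfl fun y _ => Finset.sum_singleton _ _)
  simp only [Finset.mem_filter, Finset.mem_univ, true_and, Finset.mem_singleton, Set.mem_inter_iff]
  constructor
  · rintro ⟨hx, hy⟩
    refine ⟨funext fun i => ?_, fun i hi => (hy i hi.1).trans (hx i hi.2)⟩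
    split_ifs with hi
    exacts [(hy i hi).symm, hx i (hmem i hi)]
  · rintro ⟨rfl, hy⟩
    exact ⟨fun i hi => ite_eq_right_iff.2 fun hi' => hy i ⟨hi', hi⟩, fun i hi => (if_pos hi).symm⟩

variable {P} in
theorem dependsOn_marginal {s : Set O} (hP : DependsOn P s) (S : Set V) :
    DependsOn (marginal P S) s := by
  classical
  intro a a' ha
  let replace (b x : ∀ i, Ω i) : ∀ i, Ω i := fun i => if (i : V) ∈ S then b i else x i
  refine Finset.sum_bij' (fun x _ => replace a' x) (fun x _ => replace a x) ?_ ?_ ?_ ?_ ?_ <;>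
    simp only [Finset.mem_filter, Finset.mem_univ, true_and, replace]
  · grind
  · grind
  · grind
  · grind
  · exact fun x hx => hP fun i hi => by grind

theorem marginal_mul_of_dependsOn {q : (∀ i, Ω i) → ℝ} {S : Set V}
    (hq : DependsOn q {i | (i : V) ∈ S}) : marginal (P * q) S = marginal P S * q := by
  classical
  funext a
  simp only [marginal, Pi.mul_apply, Finset.sum_mul]
  exact Finset.sum_congr rfl fun x hx => by rw [hq fun i hi => (Finset.mem_filter.1 hx).2 i hi]

theorem marginal_mul_of_disjoint {A B : Set V} (hAB : Disjoint A B) {q₁ q₂ : (∀ i, Ω i) → ℝ}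
    (h₁ : DependsOn q₁ {i | (i : V) ∉ B}) (h₂ : DependsOn q₂ {i | (i : V) ∉ A}) :
    marginal (q₁ * q₂) (A ∪ B)ᶜ = marginal q₁ Aᶜ * marginal q₂ Bᶜ := by
  have hunion : Aᶜ ∪ Bᶜ = Set.univ := by
    rw [← Set.compl_inter, hAB.inter_eq, Set.compl_empty]
  rw [Set.compl_union, ← marginal_marginal _ hunion, marginal_mul_of_dependsOn q₁ h₂,
    mul_comm, marginal_mul_of_dependsOn q₂ (dependsOn_marginal h₁ _), mul_comm]

theorem condIndepSets_of_factor {P} {D R Z X Y : Set V} (hDR : Disjoint D R)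
    (hDZ : Disjoint D Z) (hRZ : Disjoint R Z) {q₁ q₂ : (∀ i, Ω i) → ℝ}
    (hq : marginal P (D ∪ R ∪ Z) = q₁ * q₂) (h₁ : DependsOn q₁ {i | (i : V) ∉ R})
    (h₂ : DependsOn q₂ {i | (i : V) ∉ D}) (hX : X ⊆ D) (hY : Y ⊆ R) : CondIndepSets P X Y Z := by
  have hmarginal (X' Y' : Set V) (hX' : X' ⊆ D) (hY' : Y' ⊆ R) :
      marginal P (X' ∪ Y' ∪ Z) = marginal q₁ (D \ X')ᶜ * marginal q₂ (R \ Y')ᶜ := by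
    have hinter : (D ∪ R ∪ Z) ∩ (D \ X' ∪ R \ Y')ᶜ = X' ∪ Y' ∪ Z := by
      grind
    have hunion : (D ∪ R ∪ Z) ∪ (D \ X' ∪ R \ Y')ᶜ = Set.univ := by
      grind
    rw [← hinter, ← marginal_marginal P hunion, hq]
    exact marginal_mul_of_disjoint (hDR.mono Set.sdiff_subset Set.sdiff_subset)
      (fun x x' h => h₁ fun i hi => h i fun h => hi h.1)
      (fun x x' h => h₂ fun i hi => h i fun h => hi h.1)
  have hempty := hmarginal ∅ ∅ D.empty_subset R.empty_subset
  have hX := hmarginal X ∅ hX R.empty_subset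
  have hY := hmarginal ∅ Y D.empty_subset hY
  have hXY := hmarginal X Y ‹_› ‹_›
  simp only [Set.union_empty, Set.empty_union] at hempty hX hY
  intro a ha
  rw [hempty, Pi.mul_apply] at ha
  have h₁ := left_ne_zero_of_mul ha
  have h₂ := right_ne_zero_of_mul ha
  simp only [hempty, hX, hY, hXY, Pi.mul_apply]
  field_simp

end Marginal

namespace CircuitModel

variable {C : Type (u + 1)} [LargeCategory C] [MonoidalCategory C] [SymmetricCategory C]
  {T : CausalOPT C} {V : Type w} [Fintype V] {G : GDAG V} {Ω : G.observed → Type}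
  [∀ i, Finite (Ω i)] {M : CircuitModel T G Ω} {P : (∀ i, Ω i) → ℝ}

theorem event_updateAt (a : ∀ i, Ω i) (v : V) (o : G.Outcome Ω v) :
    M.event (updateAt a v o) v = M.test v (fun j => a j.1) o := by
  have hpar : (fun j => updateAt a v o j.1 : G.ParentValue Ω v) =
      fun j : {j : G.observed // G.edge j v} => a j.1 :=
    funext fun j => updateAt_of_ne a o (G.ne_of_edge j.2)
  have hout : (fun h => updateAt a v o ⟨v, h⟩ : G.Outcome Ω v) = o :=
    funext (updateAt_self a v o)
  rw [event, hpar, hout]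

variable [DecidableEq V]

theorem Subcircuit.sum_weight_node {S : Finset V} {v : V} (hv : v ∉ S)
    (hchild : ∀ w ∈ S, ¬ G.edge v w) {R : List G.UEdge}
    {f : (∀ i, Ω i) → (𝟙_ C ⟶ composite M.sys (G.inWires v ++ R))}
    (h : M.Subcircuit S (G.inWires v ++ R) f) (a : ∀ i, Ω i) [Fintype (G.Outcome Ω v)] :
    ∑ o, T.weight (f (updateAt a v o) ≫ applyFront (M.event (updateAt a v o) v) R) =
      T.weight (f a) := by
  have hcongr (o : G.Outcome Ω v) : f (updateAt a v o) = f a :=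
    h.congr fun i ⟨w, hw, hi⟩ => updateAt_of_ne a o fun hiv =>
      hi.elim (fun hiw => hv (hiv ▸ hiw ▸ hw)) fun hiw => hchild w hw (hiv ▸ hiw)
  simp only [hcongr, event_updateAt]
  exact (h.isEvent a).sum_weight ((M.isTestUpTo_test v _).applyFront R)

variable [∀ i, Fintype (Ω i)]

theorem Realises.marginal_eq_weight (hP : M.Realises P) {S : Finset V}
    (hS : ∀ a b, G.edge a b → b ∈ S → a ∈ S) {L : List G.UEdge}
    {f : (∀ i, Ω i) → (𝟙_ C ⟶ composite M.sys L)} (h : M.Subcircuit S L f) (a : ∀ i, Ω i) :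
    marginal P S a = T.weight (f a) := by
  induction hn : Sᶜ.card generalizing S L f a with
  | zero =>
    rw [Finset.card_eq_zero, Finset.compl_eq_empty_iff] at hn
    subst hn
    obtain ⟨g, hg, hPg⟩ := hP
    obtain ⟨σ, hσ, hgf⟩ := h.exists_rewiring hg.subcircuit
    rw [Finset.coe_univ, marginal_univ, hPg, ← (hg.subcircuit.isEvent a).weight_eq_prob, hgf]
    exact (h.isEvent a).weight_deterministic hσ.isDeterministic
  | succ n ih =>
    obtain ⟨v, hv, hmin⟩ := G.exists_minimal (S := (Sᶜ : Finset V))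
      (Finset.coe_nonempty.2 (Finset.card_pos.1 (by omega)))
    simp only [Finset.coe_compl, Set.mem_compl_iff, Finset.mem_coe] at hv hmin
    have hpar (b : V) (hb : G.edge b v) : b ∈ S := by_contra fun h => hmin b h hb
    obtain ⟨R, σ, hσ⟩ := h.exists_rewiring_inWires hv fun e he => hpar _ (he ▸ e.2.1)
    have hinsert (b c : V) (hbc : G.edge b c) (hc : c ∈ insert v S) : b ∈ insert v S := by
      rcases Finset.mem_insert.1 hc with rfl | hc
      exacts [Finset.mem_insert_of_mem (hpar b hbc), Finset.mem_insert_of_mem (hS b c hbc hc)]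
    have hcard : (insert v S)ᶜ.card = n := by
      rw [Finset.compl_insert, Finset.card_erase_of_mem (by simpa using hv)]
      omega
    have := Fintype.ofFinite (G.Outcome Ω v)
    have hnode (x : ∀ i, Ω i) := ih hinsert ((h.rewire hσ).node v hv) x hcard
    rw [← (h.isEvent a).weight_deterministic hσ.isDeterministic,
      ← (h.rewire hσ).sum_weight_node hv (fun w hw hvw => hv (hS v w hvw hw)) a,
      ← sum_marginal_insert P (Finset.mem_coe.not.2 hv) a]
    exact Finset.sum_congr rfl fun o _ => by rw [← Finset.coe_insert, hnode]

end CircuitModel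

/-! ### Soundness of d-separation -/

namespace GDAG

variable {V : Type w} (G : GDAG V)

theorem mem_inclusiveChildren_singleton {p v : V} :
    v ∈ G.inclusiveChildren {p} ↔ p = v ∨ G.edge p v := by
  simp [inclusiveChildren, eq_comm]

theorem subset_inclusiveAncestors (U : Set V) : U ⊆ G.inclusiveAncestors U :=
  fun v hv => ⟨v, hv, .refl⟩

theorem mem_inclusiveAncestors_of_edge {U : Set V} {a b : V} (hab : G.edge a b)
    (hb : b ∈ G.inclusiveAncestors U) : a ∈ G.inclusiveAncestors U :=
  let ⟨c, hc, hbc⟩ := hb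
  ⟨c, hc, .head hab hbc⟩

/-- The nodes at the ends of the pseudo-paths in `A` that start in `X` and do not meet `Z` after
their first node. -/
def component (A X Z : Set V) : Set V :=
  {v | ∃ a ∈ X, Relation.ReflTransGen (fun b c => c ∈ A \ Z ∧
    ¬ (G.inclusiveChildren {b} ∩ G.inclusiveChildren {c} ⊆ Aᶜ)) a v}

variable {G} {A X Y Z : Set V}

theorem subset_component : X ⊆ G.component A X Z := fun a ha => ⟨a, ha, .refl⟩

theorem component_subset (hX : X ⊆ A \ Z) : G.component A X Z ⊆ A \ Z := by
  rintro v ⟨a, ha, hav⟩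
  rcases hav.cases_tail with rfl | ⟨_, _, h⟩
  exacts [hX ha, h.1]

theorem mem_component_of_mem_inclusiveChildren (hA : ∀ a b, G.edge a b → b ∈ A → a ∈ A)
    {p p' v : V} (hp : p ∈ G.component A X Z) (hv : v ∈ A) (hpv : v ∈ G.inclusiveChildren {p})
    (hp' : p' ∉ Z) (hpv' : v ∈ G.inclusiveChildren {p'}) : p' ∈ G.component A X Z := by
  obtain ⟨a, ha, hap⟩ := hp
  refine ⟨a, ha, hap.tail ⟨⟨?_, hp'⟩, fun h => h ⟨hpv, hpv'⟩ hv⟩⟩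
  rcases G.mem_inclusiveChildren_singleton.1 hpv' with rfl | hedge
  exacts [hv, hA _ _ hedge hv]

theorem DSep.disjoint_component (h : G.DSep X Y Z) (hXZ : Disjoint X Z) :
    Disjoint Y (G.component (G.inclusiveAncestors (X ∪ Y ∪ Z)) X Z) := by
  set A := G.inclusiveAncestors (X ∪ Y ∪ Z)
  have hX : X ⊆ A \ Z := fun v hv =>
    ⟨G.subset_inclusiveAncestors _ (.inl (.inl hv)), Set.disjoint_left.1 hXZ hv⟩
  rw [Set.disjoint_left]
  rintro b hb ⟨a, ha, hab⟩
  obtain ⟨l, hl, hlast⟩ := List.exists_isChain_cons_of_relationReflTransGen hab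
  have hcomponent : ∀ v ∈ a :: l, v ∈ G.component A X Z :=
    hl.induction _ _ (fun _ _ hr ⟨a, ha, h⟩ => ⟨a, ha, h.tail hr⟩) fun _ => subset_component ha
  obtain ⟨v, hv, hvZ⟩ := h a ha b hb (a :: l)
    ⟨fun v hv h => h (component_subset hX (hcomponent v hv)).1, hl.imp fun _ _ h => h.2⟩ rfl
    (by rw [List.getLast?_eq_some_getLast (List.cons_ne_nil _ _), hlast])
  exact (component_subset hX (hcomponent v hv)).2 hvZ

end GDAG

section Soundness

variable {V : Type w} [Fintype V] [DecidableEq V] {G : GDAG V} {Ω : G.observed → Type}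
  [∀ i, Fintype (Ω i)] {P : (∀ i, Ω i) → ℝ} {A X Y Z : Set V}

/- The nodes of `A` that are, or have a parent, in the component share no unobserved edge with the
other nodes of `A`, so the circuit of `A` falls apart into two. -/
theorem CircuitModel.Realises.exists_marginal_eq_mul {C : Type (u + 1)} [LargeCategory C]
    [MonoidalCategory C] [SymmetricCategory C] {T : CausalOPT C} {M : CircuitModel T G Ω}
    (hP : M.Realises P) (hZ : Z ⊆ G.observed) (hA : ∀ a b, G.edge a b → b ∈ A → a ∈ A) :
    ∃ q₁ q₂ : (∀ i, Ω i) → ℝ, marginal P A = q₁ * q₂ ∧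
      DependsOn q₁ {i | (i : V) ∈ G.component A X Z ∪ Z} ∧
      DependsOn q₂ {i | (i : V) ∉ G.component A X Z} := by
  classical
  let S₁ : Finset V := {v | v ∈ A ∧ ∃ p ∈ G.component A X Z, v ∈ G.inclusiveChildren {p}}
  let S₂ : Finset V := {v | v ∈ A ∧ ∀ p ∈ G.component A X Z, v ∉ G.inclusiveChildren {p}}
  have hself (v : V) : v ∈ G.inclusiveChildren {v} := .inl rfl
  have hedge (e : G.UEdge) : e.1.2 ∈ G.inclusiveChildren {e.1.1} := .inr ⟨_, rfl, e.2.1⟩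
  have hnotZ (e : G.UEdge) : e.1.1 ∉ Z := fun h => e.2.2 (hZ h)
  obtain ⟨L₁, f₁, h₁⟩ := M.exists_subcircuit (S := S₁) fun e he => by
    obtain ⟨hv, p, hp, hpv⟩ := (Finset.mem_filter.1 he).2
    exact Finset.mem_filter.2 ⟨Finset.mem_univ _, hA _ _ e.2.1 hv, _,
      G.mem_component_of_mem_inclusiveChildren hA hp hv hpv (hnotZ e) (hedge e), hself _⟩
  obtain ⟨L₂, f₂, h₂⟩ := M.exists_subcircuit (S := S₂) fun e he => by
    obtain ⟨hv, hnot⟩ := (Finset.mem_filter.1 he).2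
    have ha := hA _ _ e.2.1 hv
    exact Finset.mem_filter.2 ⟨Finset.mem_univ _, ha, fun p hp hpa => hnot _
      (G.mem_component_of_mem_inclusiveChildren hA hp ha hpa (hnotZ e) (hself _)) (hedge e)⟩
  have hdisj : Disjoint S₁ S₂ := Finset.disjoint_filter.2 fun v _ ⟨_, p, hp, hpv⟩ h =>
    h.2 p hp hpv
  have hunion : ((S₁ ∪ S₂ : Finset V) : Set V) = A := by
    ext v
    simp only [S₁, S₂, ← Finset.filter_or, Finset.coe_filter, Finset.mem_univ, true_and,
      Set.mem_ofPred_eq]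
    grind
  refine ⟨fun a => T.weight (f₁ a), fun a => T.weight (f₂ a), funext fun a => ?_,
    fun a a' ha => congrArg _ (h₁.congr fun i ⟨v, hv, hi⟩ => ha i ?_),
    fun a a' ha => congrArg _ (h₂.congr fun i ⟨v, hv, hi⟩ => ha i fun hi' => ?_)⟩
  · rw [← hunion, hP.marginal_eq_weight (fun a b hab => by simpa [← hunion] using hA a b hab)
      (h₁.juxtapose h₂ hdisj)]
    exact (h₁.isEvent a).weight_juxtapose (h₂.isEvent a)
  · obtain ⟨hv, p, hp, hpv⟩ := (Finset.mem_filter.1 hv).2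
    exact or_iff_not_imp_right.2 fun hiZ => G.mem_component_of_mem_inclusiveChildren hA hp hv hpv
      hiZ (G.mem_inclusiveChildren_singleton.2 hi)
  · exact (Finset.mem_filter.1 hv).2.2 i hi' (G.mem_inclusiveChildren_singleton.2 hi)

theorem GDAG.IsGeneralisedMarkov.condIndepSets (hP : G.IsGeneralisedMarkov.{u, w} P)
    (hZ : Z ⊆ G.observed) (hXZ : Disjoint X Z) (hYZ : Disjoint Y Z) (h : G.DSep X Y Z) :
    CondIndepSets P X Y Z := by
  obtain ⟨C, _, _, _, T, M, hM⟩ := hP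
  set A := G.inclusiveAncestors (X ∪ Y ∪ Z)
  have hsub : X ∪ Y ∪ Z ⊆ A := G.subset_inclusiveAncestors _
  have hX : X ⊆ A \ Z := fun v hv => ⟨hsub (.inl (.inl hv)), Set.disjoint_left.1 hXZ hv⟩
  obtain ⟨q₁, q₂, hq, h₁, h₂⟩ := hM.exists_marginal_eq_mul (A := A) (X := X) hZ
    fun a b => G.mem_inclusiveAncestors_of_edge
  set D := G.component A X Z
  have hDA : D ⊆ A \ Z := GDAG.component_subset hX
  have hYD : Disjoint Y D := h.disjoint_component hXZ
  have hA : D ∪ A \ (D ∪ Z) ∪ Z = A := by grind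
  rw [← hA] at hq
  exact condIndepSets_of_factor (by grind) (by grind) (by grind) hq
    (fun x x' hx => h₁ fun i hi => hx i fun h => h.2 hi) h₂ GDAG.subset_component (by grind)

end Soundness

/-! ### Classical probability theory -/

section Classical

open MeasureTheory ProbabilityTheory
open scoped SFinKer

theorem id_map_apply {α β : Type*} [MeasurableSpace α] [MeasurableSpace β] {f : α → β}
    (hf : Measurable f) (a : α) : (Kernel.id : Kernel α α).map f a = Measure.dirac (f a) := by
  rw [Kernel.id_map hf, Kernel.deterministic_apply]

/-- The kernel `e` turns the point `a` into the point `b` with certainty. -/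
def Carries {A B : SFinKer.{u}} (e : A ⟶ B) (a : A) (b : B) : Prop := e.hom a = Measure.dirac b

namespace Carries

variable {A B D : SFinKer.{u}}

theorem id (a : A) : Carries (𝟙 A) a a := Kernel.id_apply a

theorem comp_apply {e : A ⟶ B} {a : A} {b : B} (h : Carries e a b) (e' : B ⟶ D) :
    (e ≫ e').hom a = e'.hom b := by
  refine (Kernel.comp_apply _ _ _).trans ?_
  rw [h, Measure.dirac_bind e'.hom.measurable]

theorem comp {e : A ⟶ B} {e' : B ⟶ D} {a : A} {b : B} {d : D} (h : Carries e a b)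
    (h' : Carries e' b d) : Carries (e ≫ e') a d :=
  (h.comp_apply e').trans h'

theorem whiskerLeft {e : A ⟶ B} {a : A} {b : B} (h : Carries e a b) (d : D) :
    Carries (D ◁ e) (d, a) (d, b) := by
  refine (Kernel.parallelComp_apply _ _ _).trans ?_
  rw [Kernel.id_apply, h, Measure.dirac_prod_dirac]

theorem whiskerRight {e : A ⟶ B} {a : A} {b : B} (h : Carries e a b) (d : D) :
    Carries (e ▷ D) (a, d) (b, d) := by
  refine (Kernel.parallelComp_apply _ _ _).trans ?_
  rw [Kernel.id_apply, h, Measure.dirac_prod_dirac]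

theorem associator_hom (a : A) (b : B) (d : D) : Carries (α_ A B D).hom ((a, b), d) (a, b, d) :=
  Kernel.deterministic_apply (MeasurableEquiv.measurable _) _

theorem associator_inv (a : A) (b : B) (d : D) : Carries (α_ A B D).inv (a, b, d) ((a, b), d) :=
  Kernel.deterministic_apply (MeasurableEquiv.measurable _) _

theorem leftUnitor_hom (a : A) : Carries (λ_ A).hom (PUnit.unit, a) a :=
  id_map_apply measurable_snd _

theorem leftUnitor_inv (a : A) : Carries (λ_ A).inv a (PUnit.unit, a) :=
  id_map_apply measurable_prodMk_left _

theorem rightUnitor_hom (a : A) : Carries (ρ_ A).hom (a, PUnit.unit) a :=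
  id_map_apply measurable_fst _

theorem rightUnitor_inv (a : A) : Carries (ρ_ A).inv a (a, PUnit.unit) :=
  id_map_apply measurable_prodMk_right _

theorem braiding (a : A) (b : B) : Carries (β_ A B).hom (a, b) (b, a) :=
  Kernel.deterministic_apply measurable_swap _

end Carries

/-- The kernel of a family of kernels whose outcome is ignored. -/
noncomputable def totalKernel {X : Type*} [Countable X] {A B : SFinKer.{u}} (t : X → (A ⟶ B)) :
    Kernel A B := Kernel.sum fun x => (t x).hom

section TotalKernel

variable {X Y : Type*} [Countable X] [Countable Y] {A B D F : SFinKer.{u}}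

instance (t : X → (A ⟶ B)) : IsSFiniteKernel (totalKernel t) :=
  inferInstanceAs (IsSFiniteKernel (Kernel.sum _))

theorem isMarkovKernel_totalKernel_of_carries {e : A ⟶ B} (φ : A → B)
    (h : ∀ a, Carries e a (φ a)) : IsMarkovKernel (totalKernel fun _ : Unit => e) := by
  refine ⟨fun a => ?_⟩
  rw [totalKernel, Kernel.sum_fintype, Fintype.sum_unique, h a]
  infer_instance

theorem totalKernel_comp (s : X → (A ⟶ B)) (t : Y → (B ⟶ D)) :
    totalKernel (fun p : X × Y => s p.1 ≫ t p.2) = totalKernel t ∘ₖ totalKernel s := by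
  ext a : 1
  simp only [totalKernel, Kernel.comp_sum_left, Kernel.comp_sum_right, Kernel.sum_apply]
  rw [Measure.sum_sum]
  rfl

theorem totalKernel_tensor (s : X → (A ⟶ B)) (t : Y → (D ⟶ F)) :
    totalKernel (fun p : X × Y => s p.1 ⊗ₘ t p.2) = totalKernel s ∥ₖ totalKernel t := by
  ext a : 1
  simp only [totalKernel, Kernel.parallelComp_sum_left, Kernel.parallelComp_sum_right,
    Kernel.sum_apply]
  rw [Measure.sum_comm, Measure.sum_sum]
  simp [MonoidalCategory.tensorHom_def, Kernel.id_parallelComp_comp_parallelComp_id]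

theorem totalKernel_apply_univ {X : Type*} [Fintype X] (t : X → (A ⟶ B)) (a : A) :
    totalKernel t a Set.univ = ∑ x, (t x).hom a Set.univ := by
  simp [totalKernel]

theorem apply_univ_le_one {t : X → (A ⟶ B)} (ht : IsMarkovKernel (totalKernel t)) (x : X)
    (a : A) : (t x).hom a Set.univ ≤ 1 := by
  rw [← (ht.isProbabilityMeasure a).measure_univ, totalKernel, Kernel.sum_apply]
  exact Measure.le_sum _ x Set.univ

theorem sum_comp_apply_univ {X : Type*} [Fintype X] {t : X → (B ⟶ D)}
    (ht : IsMarkovKernel (totalKernel t)) (r : A ⟶ B) (a : A) :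
    ∑ x, (r ≫ t x).hom a Set.univ = r.hom a Set.univ := by
  calc ∑ x, (r ≫ t x).hom a Set.univ
      = ∑ x, ∫⁻ b, (t x).hom b Set.univ ∂r.hom a :=
        Finset.sum_congr rfl fun x _ => Kernel.comp_apply' _ _ _ .univ
    _ = ∫⁻ b, totalKernel t b Set.univ ∂r.hom a := by
        simp only [totalKernel_apply_univ]
        exact (lintegral_finsetSum _ fun x _ => Kernel.measurable_coe _ .univ).symm
    _ = r.hom a Set.univ := by
        simp only [(ht.isProbabilityMeasure _).measure_univ, lintegral_one]

end TotalKernel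

/-- Classical probability theory: systems are measurable spaces, events are `s`-finite kernels, and
the kernels of a test add up to a Markov kernel. -/
noncomputable def classicalOPT : CausalOPT SFinKer.{u} where
  IsTest t := IsMarkovKernel (totalKernel t)
  isTest_id _ := isMarkovKernel_totalKernel_of_carries _ Carries.id
  isTest_associator_hom _ _ _ :=
    isMarkovKernel_totalKernel_of_carries _ fun p => .associator_hom p.1.1 p.1.2 p.2
  isTest_associator_inv _ _ _ :=
    isMarkovKernel_totalKernel_of_carries _ fun p => .associator_inv p.1 p.2.1 p.2.2
  isTest_leftUnitor_hom _ := isMarkovKernel_totalKernel_of_carries _ fun p => .leftUnitor_hom p.2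
  isTest_leftUnitor_inv _ := isMarkovKernel_totalKernel_of_carries _ .leftUnitor_inv
  isTest_rightUnitor_hom _ := isMarkovKernel_totalKernel_of_carries _ fun p => .rightUnitor_hom p.1
  isTest_rightUnitor_inv _ := isMarkovKernel_totalKernel_of_carries _ .rightUnitor_inv
  isTest_braiding _ _ := isMarkovKernel_totalKernel_of_carries _ fun p => .braiding p.1 p.2
  isTest_comp s t _ _ := totalKernel_comp s t ▸ inferInstance
  isTest_tensor s t _ _ := totalKernel_tensor s t ▸
    inferInstanceAs (IsMarkovKernel (totalKernel s ∥ₖ totalKernel t))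
  prob f := (f.hom PUnit.unit Set.univ).toReal
  prob_test t ht := by
    refine ⟨fun x => ENNReal.toReal_nonneg, ?_⟩
    rw [← ENNReal.toReal_sum fun x _ =>
        ne_top_of_le_ne_top ENNReal.one_ne_top (apply_univ_le_one ht x _),
      ← totalKernel_apply_univ, ht.isProbabilityMeasure _ |>.measure_univ, ENNReal.toReal_one]
  prob_comp s t _ _ x y := by
    rw [← ENNReal.toReal_mul, mul_comm]
    refine congrArg _ ((Kernel.comp_apply' _ _ _ .univ).trans ?_)
    exact lintegral_const ((t y).hom PUnit.unit Set.univ)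
  exists_deterministic A :=
    ⟨⟨Kernel.discard A, by rw [Kernel.discard]; infer_instance⟩,
      isMarkovKernel_totalKernel_of_carries (fun _ => PUnit.unit) Kernel.discard_apply⟩
  deterministic_unique {X Y _ _ A} a e r ha he hr y := by
    have := Fintype.ofFinite Y
    have hle (x) : (r y ≫ a x).hom PUnit.unit Set.univ ≤ 1 :=
      (Finset.single_le_sum_of_canonicallyOrdered
        (f := fun x => (r y ≫ a x).hom PUnit.unit Set.univ) (Finset.mem_univ x)).trans
        ((sum_comp_apply_univ ha (r y) _).trans_le (apply_univ_le_one hr y _))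
    have he := sum_comp_apply_univ he (r y) PUnit.unit
    rw [Fintype.sum_unique] at he
    rw [← ENNReal.toReal_sum fun x _ => ne_top_of_le_ne_top ENNReal.one_ne_top (hle x),
      sum_comp_apply_univ ha, he]

end Classical

/-! ### Functional models -/

section Mixtures

open MeasureTheory ProbabilityTheory
open scoped SFinKer

variable {A B D : SFinKer.{u}} {ι : Type*} {e : A ⟶ B} {a : A} {c : ENNReal} {s : Finset ι}
  {b : ι → B}

theorem comp_apply_of_mixture (h : e.hom a = c • ∑ i ∈ s, Measure.dirac (b i)) (e' : B ⟶ D) :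
    (e ≫ e').hom a = c • ∑ i ∈ s, e'.hom (b i) := by
  refine (Kernel.comp_apply _ _ _).trans ?_
  ext t ht
  rw [h, Measure.bind_apply ht e'.hom.measurable.aemeasurable, lintegral_smul_measure,
    lintegral_finsetSum_measure]
  simp [lintegral_dirac' _ (Kernel.measurable_coe e'.hom ht)]

theorem whiskerRight_apply_of_mixture (h : e.hom a = c • ∑ i ∈ s, Measure.dirac (b i)) (d : D) :
    (e ▷ D).hom (a, d) = c • ∑ i ∈ s, Measure.dirac (b i, d) := by
  refine (Kernel.parallelComp_apply _ _ _).trans ?_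
  rw [h, Kernel.id_apply, Measure.prod_dirac, Measure.map_smul,
    Measure.map_finset_sum measurable_prodMk_right.aemeasurable]
  simp only [Measure.map_dirac' measurable_prodMk_right]

theorem mixture_apply_univ : (c • ∑ i ∈ s, Measure.dirac (b i)) Set.univ = c * s.card := by
  simp

end Mixtures

section Points

open MeasureTheory ProbabilityTheory
open scoped SFinKer

variable {E : Type w} {sys : E → SFinKer.{u}}

instance [∀ e, Finite (sys e)] (L : List E) : Finite (composite sys L : SFinKer.{u}) := by
  induction L with
  | nil => exact inferInstanceAs (Finite PUnit)
  | cons e L ih => exact inferInstanceAs (Finite (sys e × (composite sys L : SFinKer.{u})))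

instance [∀ e, MeasurableSingletonClass (sys e)] (L : List E) :
    MeasurableSingletonClass (composite sys L : SFinKer.{u}) := by
  induction L with
  | nil => exact inferInstanceAs (MeasurableSingletonClass PUnit)
  | cons e L ih =>
    exact inferInstanceAs (MeasurableSingletonClass (sys e × (composite sys L : SFinKer.{u})))

/-- The element of a composite with prescribed values on the wires. -/
def point (y : ∀ e, sys e) : ∀ L : List E, (composite sys L : SFinKer.{u})
  | [] => PUnit.unit
  | e :: L => (y e, point y L)

open Classical in
/-- The value on the wire `e`, with default `d e` if `e` is not in the list. -/
noncomputable def readWire (d : ∀ e, sys e) (e : E) :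
    ∀ (L : List E) (_ : (composite sys L : SFinKer.{u})), sys e
  | [], _ => d e
  | e' :: L, q => if h : e' = e then h ▸ q.1 else readWire d e L q.2

variable (y : ∀ e, sys e)

theorem readWire_point (d : ∀ e, sys e) {e : E} {L : List E} (he : e ∈ L) :
    readWire d e L (point y L) = y e := by
  induction L with
  | nil => cases he
  | cons e' L ih =>
    by_cases h : e' = e
    · subst h
      exact dif_pos rfl
    · exact (dif_neg h).trans (ih ((List.mem_cons.1 he).resolve_left (Ne.symm h)))

variable {y} in
theorem point_congr {y' : ∀ e, sys e} {L : List E} (h : ∀ e ∈ L, y e = y' e) :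
    point y L = point y' L := by
  induction L with
  | nil => rfl
  | cons e L ih =>
    exact Prod.ext (h e List.mem_cons_self) (ih fun e he => h e (List.mem_cons_of_mem _ he))

theorem Rewiring.carries {L L' : List E} {σ : composite sys L ⟶ composite sys L'}
    (h : Rewiring sys L L' σ) : Carries σ (point y L) (point y L') := by
  induction h with
  | nil => exact .id _
  | cons e _ ih => exact ih.whiskerLeft (y e)
  | swap e e' L =>
    exact (Carries.associator_inv (y e) (y e') (point y L)).comp
      (((Carries.braiding (y e) (y e')).whiskerRight (point y L)).comp
        (.associator_hom (y e') (y e) (point y L)))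
  | trans _ _ ih ih' => exact ih.comp ih'

theorem carries_compositeAppend_hom (R L : List E) :
    Carries (compositeAppend sys R L).hom (point y (L ++ R)) (point y L, point y R) := by
  induction L with
  | nil => exact .leftUnitor_inv _
  | cons e L ih => exact (ih.whiskerLeft (y e)).comp (.associator_inv (y e) (point y L) (point y R))

theorem carries_compositeAppend_inv (R L : List E) :
    Carries (compositeAppend sys R L).inv (point y L, point y R) (point y (L ++ R)) := by
  induction L with
  | nil => exact .leftUnitor_hom _
  | cons e L ih =>
    exact (Carries.associator_hom (y e) (point y L) (point y R)).comp (ih.whiskerLeft (y e))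

theorem applyFront_apply_point {A B : List E} {h : composite sys A ⟶ composite sys B} {ι : Type*}
    {c : ENNReal} {s : Finset ι} {y' : ι → ∀ e, sys e} {R : List E}
    (hh : h.hom (point y A) = c • ∑ i ∈ s, Measure.dirac (point (y' i) B))
    (hR : ∀ i ∈ s, ∀ e ∈ R, y' i e = y e) :
    (applyFront h R).hom (point y (A ++ R)) =
      c • ∑ i ∈ s, Measure.dirac (point (y' i) (B ++ R)) := by
  refine ((carries_compositeAppend_hom y R A).comp_apply _).trans
    ((comp_apply_of_mixture (whiskerRight_apply_of_mixture hh (point y R)) _).trans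
      (congrArg (c • ·) (Finset.sum_congr rfl fun i hi => ?_)))
  rw [← point_congr (hR i hi)]
  exact carries_compositeAppend_inv (y' i) R B

end Points

theorem sum_sum_update {V N M : Type*} [Fintype V] [DecidableEq V] [Fintype N] [AddCommMonoid M]
    (v : V) (F : (V → N) → M) :
    ∑ r, ∑ β, F (Function.update r v β) = Fintype.card N • ∑ r, F r := by
  have hinv : Function.Involutive fun p : (V → N) × N => (Function.update p.1 v p.2, p.1 v) :=
    fun p => by simp
  calc ∑ r, ∑ β, F (Function.update r v β)
      = ∑ p : (V → N) × N, F (Function.update p.1 v p.2) := (Fintype.sum_prod_type' _).symm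
    _ = ∑ p : (V → N) × N, F p.1 := Equiv.sum_comp hinv.toPerm fun p => F p.1
    _ = Fintype.card N • ∑ r, F r := by
        rw [Fintype.sum_prod_type_right]
        simp

open Classical in
theorem sum_sum_update_of_mem {V N M : Type*} [Fintype V] [DecidableEq V] [Fintype N]
    [AddCommMonoid M] {v : V} {s t : Finset (V → N)}
    (h : ∀ r β, Function.update r v β ∈ t → r ∈ s) (F : (V → N) → M) :
    ∑ r ∈ s, ∑ β with Function.update r v β ∈ t, F (Function.update r v β) =
      Fintype.card N • ∑ r ∈ t, F r := by
  calc ∑ r ∈ s, ∑ β with Function.update r v β ∈ t, F (Function.update r v β)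
      = ∑ r, ∑ β with Function.update r v β ∈ t, F (Function.update r v β) :=
        Finset.sum_subset (Finset.subset_univ s) fun r _ hr => by
          rw [Finset.filter_false_of_mem fun β _ hβ => hr (h r β hβ), Finset.sum_empty]
    _ = ∑ r, ∑ β, if Function.update r v β ∈ t then F (Function.update r v β) else 0 := by
        simp only [Finset.sum_filter]
    _ = Fintype.card N • ∑ r, if r ∈ t then F r else 0 :=
        sum_sum_update v fun r => if r ∈ t then F r else 0
    _ = Fintype.card N • ∑ r ∈ t, F r := by rw [Finset.sum_ite_mem, Finset.univ_inter]

section UniformMixtures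

open MeasureTheory

variable {α : Type*} [MeasurableSpace α]

theorem inv_natCast_smul_nsmul {α : Type*} [MeasurableSpace α] {n : ℕ} (hn : n ≠ 0)
    (μ : Measure α) : (n : ENNReal)⁻¹ • n • μ = μ := by
  rw [← Nat.cast_smul_eq_nsmul ENNReal, smul_smul,
    ENNReal.inv_mul_cancel (by simpa) (ENNReal.natCast_ne_top n), one_smul]

theorem inv_card_smul_sum_const {ι : Type*} [Fintype ι] [Nonempty ι] (μ : Measure α) :
    (Fintype.card ι : ENNReal)⁻¹ • ∑ _i : ι, μ = μ := by
  rw [Finset.sum_const, Finset.card_univ, inv_natCast_smul_nsmul Fintype.card_ne_zero]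

open Classical in
theorem sum_inv_card_smul_sum_update {V N : Type*} [Fintype V] [DecidableEq V] [Fintype N]
    [Nonempty N] {v : V} {s t : Finset (V → N)}
    (h : ∀ r β, Function.update r v β ∈ t → r ∈ s) (F : (V → N) → Measure α) :
    ∑ r ∈ s, (Fintype.card N : ENNReal)⁻¹ •
        ∑ β with Function.update r v β ∈ t, F (Function.update r v β) = ∑ r ∈ t, F r := by
  rw [← Finset.smul_sum, sum_sum_update_of_mem h, inv_natCast_smul_nsmul Fintype.card_ne_zero]

end UniformMixtures

/-- A deterministic mechanism for each node, which computes the value of the node in `K` from an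
independent noise variable in `N` and the values of its parents. The field `value` records the
solution of these structural equations, which is unique. -/
structure FunctionalModel {V : Type w} (G : GDAG V) (N K : Type) where
  mechanism : ∀ v, N → ({p // G.edge p v} → K) → K
  value : (V → N) → V → K
  value_eq : ∀ r v, value r v = mechanism v (r v) fun p => value r p

namespace FunctionalModel

section Value

variable {V : Type w} [Finite V] {G : GDAG V} {N K : Type} (F : FunctionalModel G N K)

theorem value_congr {S : Finset V} (hS : ∀ a v, G.edge a v → v ∈ S → a ∈ S) {r r' : V → N}
    (hr : ∀ v ∈ S, r v = r' v) : ∀ v ∈ S, F.value r v = F.value r' v := by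
  classical
  refine G.topological_induction (p := fun S => (∀ v ∈ S, r v = r' v) →
    ∀ v ∈ S, F.value r v = F.value r' v) (fun _ _ => id) (by simp) ?_ hS hr
  intro v S _ hpar ih hr
  rw [Finset.forall_mem_insert] at hr
  have hvalue := ih hr.2
  refine (Finset.forall_mem_insert _ _ _).2 ⟨?_, hvalue⟩
  rw [F.value_eq, F.value_eq r', hr.1]
  exact congrArg _ (funext fun p => hvalue p (hpar p p.2))

variable [DecidableEq V]

theorem value_update_of_mem {S : Finset V} (hS : ∀ a v, G.edge a v → v ∈ S → a ∈ S) {v : V}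
    (hv : v ∉ S) (r : V → N) (β : N) {a : V} (ha : a ∈ S) :
    F.value (Function.update r v β) a = F.value r a :=
  F.value_congr hS (fun _ hb => Function.update_of_ne (ne_of_mem_of_not_mem hb hv) β r) a ha

theorem value_update_self {S : Finset V} (hS : ∀ a v, G.edge a v → v ∈ S → a ∈ S) {v : V}
    (hv : v ∉ S) (hpar : ∀ a, G.edge a v → a ∈ S) (r : V → N) (β : N) :
    F.value (Function.update r v β) v = F.mechanism v β fun p => F.value r p := by
  rw [F.value_eq, Function.update_self]
  exact congrArg _ (funext fun p => F.value_update_of_mem hS hv r β (hpar p p.2))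

end Value

section NoiseOn

variable {V : Type w} [Fintype V] [DecidableEq V] {G : GDAG V} {N K : Type} [Fintype N]
  (F : FunctionalModel G N K)

open Classical in
/-- The noise of all nodes for which the observed nodes in `S` have values `x`. -/
noncomputable def noiseOn (S : Finset V) (x : G.observed → K) : Finset (V → N) :=
  {r | ∀ i : G.observed, (i : V) ∈ S → F.value r i = x i}

theorem mem_noiseOn {S : Finset V} {x : G.observed → K} {r : V → N} :
    r ∈ F.noiseOn S x ↔ ∀ i : G.observed, (i : V) ∈ S → F.value r i = x i := by
  simp [noiseOn]

theorem update_mem_noiseOn_insert {S : Finset V} (hS : ∀ a v, G.edge a v → v ∈ S → a ∈ S)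
    {v : V} (hv : v ∉ S) {x : G.observed → K} {r : V → N} {β : N} :
    Function.update r v β ∈ F.noiseOn (insert v S) x ↔
      (∀ h : v ∈ G.observed, F.value (Function.update r v β) v = x ⟨v, h⟩) ∧
        r ∈ F.noiseOn S x := by
  have hcongr (i : G.observed) (hi : (i : V) ∈ S) := F.value_update_of_mem hS hv r β hi
  simp only [mem_noiseOn, Finset.mem_insert]
  refine ⟨fun h => ⟨fun hvo => h ⟨v, hvo⟩ (.inl rfl), fun i hi => ?_⟩, fun h i hi => ?_⟩
  · rw [← hcongr i hi, h i (.inr hi)]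
  · obtain ⟨i, hio⟩ := i
    rcases hi with rfl | hi
    · exact h.1 hio
    · exact (hcongr _ hi).trans (h.2 _ hi)

end NoiseOn

section CircuitModel

open MeasureTheory ProbabilityTheory
open scoped SFinKer

/-- The discrete measurable space `K`, as a system of classical probability theory. -/
def discreteSystem (K : Type) : SFinKer.{u} where
  carrier := ULift.{u} K
  str := ⊤

instance {K : Type} [Finite K] : Finite (discreteSystem.{u} K) :=
  inferInstanceAs (Finite (ULift K))

instance {K : Type} : MeasurableSingletonClass (discreteSystem.{u} K) :=
  ⟨fun _ => MeasurableSpace.measurableSet_top⟩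

variable {V : Type w} {G : GDAG V} {N K : Type}

/-- The point of a composite at which every wire carries the value at its source. -/
def sourcePoint (y : V → K) (L : List G.UEdge) :
    (composite (fun _ : G.UEdge => discreteSystem.{u} K) L : SFinKer.{u}) :=
  point (sys := fun _ => discreteSystem K) (fun e => ULift.up (y e.1.1)) L

section ParentValues

variable [Finite V] [Inhabited K] {v : V}

open Classical in
/-- The values at the parents of `v`, when the observed parents have values `c` and the incoming
wires carry `q`. -/
noncomputable def parentValues (c : G.ParentValue (fun _ => K) v)
    (q : (composite (fun _ : G.UEdge => discreteSystem.{u} K) (G.inWires v) : SFinKer.{u}))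
    (p : {p // G.edge p v}) : K :=
  if h : p.1 ∈ G.observed then c ⟨⟨p, h⟩, p.2⟩
  else (readWire (fun _ => ULift.up default) ⟨(p, v), p.2, h⟩ _ q).down

theorem parentValues_sourcePoint {c : G.ParentValue (fun _ => K) v} {y : V → K}
    (hc : ∀ j, c j = y j.1) :
    parentValues.{u} c (sourcePoint y (G.inWires v)) = fun p => y p.1 := by
  funext p
  rw [parentValues]
  split
  · exact hc _
  · exact congrArg ULift.down (readWire_point _ _ (G.mem_inWires.2 rfl))

end ParentValues

variable (F : FunctionalModel G N K)

section Noise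

variable [Fintype N] {v : V}

open Classical in
/-- The noise values at `v` that lead to the outcome `o`, given the values `y` of the parents. -/
noncomputable def noise (v : V) (y : {p // G.edge p v} → K) (o : G.Outcome (fun _ => K) v) :
    Finset N :=
  {β | (fun _ => F.mechanism v β y) = o}

theorem mem_noise {y : {p // G.edge p v} → K} {o : G.Outcome (fun _ => K) v} {β : N} :
    β ∈ F.noise v y o ↔ ∀ h, F.mechanism v β y = o h := by
  simp [noise, funext_iff]

theorem sum_card_noise [Fintype (G.Outcome (fun _ => K) v)] (y : {p // G.edge p v} → K) :
    ∑ o, (F.noise v y o).card = Fintype.card N := by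
  classical
  exact (Finset.card_eq_sum_card_fiberwise fun _ _ => Finset.mem_univ _).symm

end Noise

variable [Fintype V] [Inhabited K] [Finite K] [Fintype N] {v : V}

/-- The kernel of the event at `v` with outcome `o`, given the values `c` of the observed parents:
the noise is uniform and the value of `v` is sent along all outgoing wires. -/
noncomputable def nodeKernel (v : V) (c : G.ParentValue (fun _ => K) v)
    (o : G.Outcome (fun _ => K) v) :
    Kernel (composite (fun _ : G.UEdge => discreteSystem.{u} K) (G.inWires v) : SFinKer.{u})
      (composite (fun _ : G.UEdge => discreteSystem.{u} K) (G.outWires v) : SFinKer.{u}) where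
  toFun q := (Fintype.card N : ENNReal)⁻¹ • ∑ β ∈ F.noise v (parentValues c q) o,
    Measure.dirac (sourcePoint (fun _ => F.mechanism v β (parentValues c q)) _)
  measurable' := .of_discrete

theorem nodeKernel_apply_univ (c : G.ParentValue (fun _ => K) v) (o : G.Outcome (fun _ => K) v)
    (q : (composite (fun _ : G.UEdge => discreteSystem.{u} K) (G.inWires v) : SFinKer.{u})) :
    F.nodeKernel v c o q Set.univ =
      (Fintype.card N : ENNReal)⁻¹ * (F.noise v (parentValues c q) o).card :=
  mixture_apply_univ

instance (c : G.ParentValue (fun _ => K) v) (o : G.Outcome (fun _ => K) v) :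
    IsFiniteKernel (F.nodeKernel.{u} v c o) := by
  refine ⟨⟨1, ENNReal.one_lt_top, fun q => ?_⟩⟩
  rw [nodeKernel_apply_univ, mul_comm, ← div_eq_mul_inv]
  exact ENNReal.div_le_of_le_mul (by simpa using Finset.card_le_univ _)

variable [Nonempty N]

/-- The circuit model in which every node sends its value along all outgoing wires. -/
noncomputable def circuitModel : CircuitModel classicalOPT.{u} G (fun _ => K) where
  sys _ := discreteSystem K
  test v c o := ⟨F.nodeKernel v c o, inferInstance⟩
  isTest v c := by
    have := Fintype.ofFinite (G.Outcome (fun _ => K) v)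
    refine ⟨fun q => ⟨(totalKernel_apply_univ _ q).trans ?_⟩⟩
    simp only [nodeKernel_apply_univ]
    rw [← Finset.mul_sum, ← Nat.cast_sum, sum_card_noise]
    exact ENNReal.inv_mul_cancel (by simp) (ENNReal.natCast_ne_top _)

variable [DecidableEq V] {S : Finset V} {x : G.observed → K}

open Classical in
theorem event_sourcePoint (hS : ∀ a v, G.edge a v → v ∈ S → a ∈ S) (hv : v ∉ S)
    (hpar : ∀ a, G.edge a v → a ∈ S) {r : V → N} (hr : r ∈ F.noiseOn S x) :
    (F.circuitModel.{u}.event x v).hom (sourcePoint (F.value r) (G.inWires v)) =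
      (Fintype.card N : ENNReal)⁻¹ •
        ∑ β with Function.update r v β ∈ F.noiseOn (insert v S) x,
          Measure.dirac (sourcePoint (F.value (Function.update r v β)) (G.outWires v)) := by
  have hparents : parentValues.{u} (fun j => x j.1) (sourcePoint (F.value r) (G.inWires v)) =
      fun p => F.value r p.1 :=
    parentValues_sourcePoint fun j => (F.mem_noiseOn.1 hr j.1 (hpar _ j.2)).symm
  change (Fintype.card N : ENNReal)⁻¹ • ∑ β ∈ F.noise v (parentValues.{u} _ _) _,
    Measure.dirac (sourcePoint (fun _ => F.mechanism v β (parentValues.{u} _ _)) _) = _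
  rw [hparents]
  refine congrArg _ (Finset.sum_congr ?_ fun β _ => congrArg _ (point_congr fun e he => ?_))
  · ext β
    rw [mem_noise, Finset.mem_filter_univ, F.update_mem_noiseOn_insert hS hv,
      F.value_update_self hS hv hpar, and_iff_left hr]
  · rw [← F.value_update_self hS hv hpar, G.mem_outWires.1 he]

open Classical in
theorem applyFront_event_sourcePoint (hS : ∀ a v, G.edge a v → v ∈ S → a ∈ S) (hv : v ∉ S)
    (hpar : ∀ a, G.edge a v → a ∈ S) {R : List G.UEdge} (hR : ∀ e ∈ R, e.1.1 ∈ S) {r : V → N}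
    (hr : r ∈ F.noiseOn S x) :
    (applyFront (F.circuitModel.{u}.event x v) R).hom
        (sourcePoint (F.value r) (G.inWires v ++ R)) =
      (Fintype.card N : ENNReal)⁻¹ •
        ∑ β with Function.update r v β ∈ F.noiseOn (insert v S) x,
          Measure.dirac (sourcePoint (F.value (Function.update r v β)) (G.outWires v ++ R)) :=
  applyFront_apply_point (sys := F.circuitModel.sys) (fun e => ULift.up (F.value r e.1.1))
    (y' := fun β e => ULift.up (F.value (Function.update r v β) e.1.1))
    (F.event_sourcePoint hS hv hpar hr)
    fun β _ e he => congrArg ULift.up (F.value_update_of_mem hS hv r β (hR e he))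

theorem partial_apply {L : List G.UEdge}
    {f : (G.observed → K) → (𝟙_ SFinKer.{u} ⟶ composite F.circuitModel.sys L)}
    (hf : F.circuitModel.Partial S L f) (x : G.observed → K) :
    (f x).hom PUnit.unit = (Fintype.card (V → N) : ENNReal)⁻¹ •
      ∑ r ∈ F.noiseOn S x, Measure.dirac (sourcePoint (F.value r) L) := by
  induction hf with
  | empty =>
    have hempty : F.noiseOn ∅ x = Finset.univ := by
      ext r
      simp [mem_noiseOn]
    rw [hempty]
    exact (Kernel.id_apply _).trans (inv_card_smul_sum_const _).symm
  | rewire _ hσ ih =>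
    refine (comp_apply_of_mixture ih _).trans ?_
    exact congrArg _ (Finset.sum_congr rfl fun r _ => hσ.carries _)
  | @node S v R f hv hpar hf ih =>
    have hclosed : ∀ a v, G.edge a v → v ∈ S → a ∈ S := fun _ _ => hf.edge_mem
    have hR (e) (he : e ∈ R) := (hf.subcircuit.mem_iff.1 (List.mem_append_right _ he)).1
    have hnode (r) (hr : r ∈ F.noiseOn S x) :=
      F.applyFront_event_sourcePoint.{u} hclosed hv hpar hR hr
    have hsub (r : V → N) (β : N)
        (hr : Function.update r v β ∈ F.noiseOn (insert v S) x) : r ∈ F.noiseOn S x :=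
      ((F.update_mem_noiseOn_insert hclosed hv).1 hr).2
    refine (comp_apply_of_mixture ih _).trans (congrArg _ ?_)
    exact (Finset.sum_congr rfl hnode).trans (sum_inv_card_smul_sum_update hsub
      fun r => Measure.dirac (sourcePoint (F.value r) (G.outWires v ++ R)))

end CircuitModel

section Law

variable {V : Type w} [Fintype V] [DecidableEq V] {G : GDAG V} {N K : Type} [Fintype N]
  (F : FunctionalModel G N K)

/-- The joint distribution of the observed variables for independent uniform noise. -/
noncomputable def law (x : G.observed → K) : ℝ :=
  (F.noiseOn Finset.univ x).card / Fintype.card (V → N)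

theorem law_nonneg (x : G.observed → K) : 0 ≤ F.law x := by
  unfold law
  positivity

variable [Nonempty N]

theorem law_ne_zero_iff {x : G.observed → K} :
    F.law x ≠ 0 ↔ ∃ r, ∀ i : G.observed, F.value r i = x i := by
  simp [law, Finset.eq_empty_iff_forall_notMem, mem_noiseOn, Fintype.card_ne_zero]

theorem marginal_law_ne_zero_iff [Fintype K] {S : Set V} {a : G.observed → K} :
    marginal F.law S a ≠ 0 ↔ ∃ r, ∀ i : G.observed, (i : V) ∈ S → F.value r i = a i := by
  rw [marginal, Ne, Finset.sum_eq_zero_iff_of_nonneg fun x _ => F.law_nonneg x]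
  push Not
  simp only [F.law_ne_zero_iff, Finset.mem_filter_univ]
  refine ⟨fun ⟨x, hx, r, hr⟩ => ⟨r, fun i hi => (hr i).trans (hx i hi)⟩, fun ⟨r, hr⟩ => ?_⟩
  exact ⟨fun i => F.value r i, hr, r, fun _ => rfl⟩

theorem law_mem_stdSimplex [Fintype K] : F.law ∈ stdSimplex ℝ (G.observed → K) := by
  classical
  refine ⟨F.law_nonneg, ?_⟩
  have hcount : ∑ x, (F.noiseOn Finset.univ x).card = Fintype.card (V → N) := by
    rw [← Finset.card_univ]
    convert (Finset.card_eq_sum_card_fiberwise (s := Finset.univ) (t := Finset.univ)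
      (f := fun r (i : G.observed) => F.value r i) fun _ _ => Finset.mem_univ _).symm using 3
    ext r
    simp [mem_noiseOn, funext_iff]
  simp only [law]
  rw [← Finset.sum_div, ← Nat.cast_sum, hcount, div_self (by simp)]

theorem isGeneralisedMarkov_law [Inhabited K] [Finite K] : G.IsGeneralisedMarkov.{u} F.law := by
  obtain ⟨f, hf⟩ := F.circuitModel.{u}.exists_partial_univ
  refine ⟨_, _, _, _, _, _, f, hf, fun x => ?_⟩
  have hx : (f x).hom PUnit.unit Set.univ =
      (Fintype.card (V → N) : ENNReal)⁻¹ * (F.noiseOn Finset.univ x).card :=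
    (congrArg (· Set.univ) (F.partial_apply hf x)).trans mixture_apply_univ
  refine (Eq.trans (congrArg ENNReal.toReal hx) ?_).symm
  rw [ENNReal.toReal_mul, ENNReal.toReal_inv, ENNReal.toReal_natCast, ENNReal.toReal_natCast,
    mul_comm, law, div_eq_mul_inv]

end Law

end FunctionalModel

/-! ### Completeness of d-separation -/

namespace GDAG

section Feeds

variable {V : Type w} (G : GDAG V) (Z : Set V)

/-- There is a directed path from `s` to `v` on which no node, except possibly the end `v` of a path
of positive length, is in `Z`. -/
def Feeds (s v : V) : Prop :=
  s ∉ Z ∧ Relation.ReflTransGen (fun a b => G.edge a b ∧ a ∉ Z) s v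

/-- The nodes `s` and `t` are joined by a chain of nodes of which any two consecutive ones feed a
common node of `Z`. -/
def Linked : V → V → Prop :=
  Relation.ReflTransGen fun p p' => ∃ z ∈ Z, G.Feeds Z p z ∧ G.Feeds Z p' z

variable {G Z} {X Y : Set V}

theorem feeds_self {v : V} (hv : v ∉ Z) : G.Feeds Z v v := ⟨hv, .refl⟩

theorem feeds_iff {s v : V} :
    G.Feeds Z s v ↔ (v ∉ Z ∧ s = v) ∨ ∃ p : {p // G.edge p v}, p.1 ∉ Z ∧ G.Feeds Z s p := by
  constructor
  · rintro ⟨hs, h⟩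
    rcases h.cases_tail with rfl | ⟨p, hp, hpv, hpZ⟩
    · exact .inl ⟨hs, rfl⟩
    · exact .inr ⟨⟨p, hpv⟩, hpZ, hs, hp⟩
  · rintro (⟨h, rfl⟩ | ⟨⟨p, hpv⟩, hpZ, hs, hp⟩)
    · exact feeds_self h
    · exact ⟨hs, hp.tail ⟨hpv, hpZ⟩⟩

theorem exists_reflTransGen_of_mem_inclusiveAncestors {U : Set V} (hZ : Z ⊆ U) {v : V}
    (hv : v ∈ G.inclusiveAncestors U) :
    ∃ c ∈ U, Relation.ReflTransGen (fun a b => G.edge a b ∧ a ∉ Z) v c := by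
  obtain ⟨c, hc, hvc⟩ := hv
  induction hvc using Relation.ReflTransGen.head_induction_on with
  | refl => exact ⟨c, hc, .refl⟩
  | @head v w hvw _ ih =>
    by_cases hv : v ∈ Z
    · exact ⟨v, hZ hv, .refl⟩
    · exact ih.imp fun d ⟨hd, hwd⟩ => ⟨hd, .head ⟨hvw, hv⟩ hwd⟩

theorem exists_common_feeds {U : Set V} (hZ : Z ⊆ U) {p p' : V} (hp : p ∉ Z) (hp' : p' ∉ Z)
    (h : ¬ (G.inclusiveChildren {p} ∩ G.inclusiveChildren {p'} ⊆ (G.inclusiveAncestors U)ᶜ)) :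
    ∃ c ∈ U, G.Feeds Z p c ∧ G.Feeds Z p' c := by
  obtain ⟨v, ⟨hv, hv'⟩, hvA⟩ := Set.not_subset.1 h
  obtain ⟨c, hc, hvc⟩ := exists_reflTransGen_of_mem_inclusiveAncestors hZ (not_not.1 hvA)
  have hfeeds {q : V} (hq : q ∉ Z) (hqv : v ∈ G.inclusiveChildren {q}) : G.Feeds Z q c := by
    rcases G.mem_inclusiveChildren_singleton.1 hqv with rfl | hedge
    exacts [⟨hq, hvc⟩, ⟨hq, .head ⟨hedge, hq⟩ hvc⟩]
  exact ⟨c, hc, hfeeds hp hv, hfeeds hp' hv'⟩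

theorem linked_of_mem_component (hXZ : Disjoint X Z) {v : V}
    (hv : v ∈ G.component (G.inclusiveAncestors (X ∪ Y ∪ Z)) X Z) :
    v ∉ Z ∧ ((∃ x ∈ X, ∃ s, G.Feeds Z s x ∧ G.Linked Z s v) ∨
      ∃ x ∈ X, ∃ y ∈ Y, ∃ s t, G.Feeds Z s x ∧ G.Feeds Z t y ∧ G.Linked Z s t) := by
  obtain ⟨a, ha, hav⟩ := hv
  have haZ := Set.disjoint_left.1 hXZ ha
  induction hav with
  | refl => exact ⟨haZ, .inl ⟨a, ha, a, feeds_self haZ, .refl⟩⟩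
  | @tail p p' _ hpp' ih =>
    obtain ⟨hp, hlinked⟩ := ih
    refine ⟨hpp'.1.2, hlinked.elim (fun ⟨x, hx, s, hsx, hsp⟩ => ?_) .inr⟩
    obtain ⟨c, hc, hpc, hpc'⟩ := exists_common_feeds Set.subset_union_right hp hpp'.1.2 hpp'.2
    rcases hc with (hc | hc) | hc
    · exact .inl ⟨c, hc, p', hpc', .refl⟩
    · exact .inr ⟨x, hx, c, hc, s, p, hsx, hpc, hsp⟩
    · exact .inl ⟨x, hx, s, hsx, hsp.tail ⟨c, hc, hpc, hpc'⟩⟩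

theorem dSep_of_disjoint_component
    (h : Disjoint Y (G.component (G.inclusiveAncestors (X ∪ Y ∪ Z)) X Z)) : G.DSep X Y Z := by
  intro a ha b hb l hl hhead hlast
  by_contra! hlZ
  obtain ⟨l, rfl⟩ := List.head?_eq_some_iff.1 hhead
  refine Set.disjoint_left.1 h hb ⟨a, ha, ?_⟩
  refine List.relationReflTransGen_of_exists_isChain_cons l ?_
    ((List.getLast_eq_iff_getLast?_eq_some _).2 hlast)
  exact hl.2.imp_of_mem_imp fun _ c _ hc hbc => ⟨⟨not_not.1 (hl.1 c hc), hlZ c hc⟩, hbc⟩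

theorem exists_linked_of_not_dSep (hXZ : Disjoint X Z) (h : ¬ G.DSep X Y Z) :
    ∃ x ∈ X, ∃ y ∈ Y, ∃ s t, G.Feeds Z s x ∧ G.Feeds Z t y ∧ G.Linked Z s t := by
  obtain ⟨b, hbY, hb⟩ := Set.not_disjoint_iff.1 (mt dSep_of_disjoint_component h)
  obtain ⟨hbZ, ⟨x, hx, s, hsx, hsb⟩ | hlinked⟩ := linked_of_mem_component hXZ hb
  · exact ⟨x, hx, b, hbY, s, b, hsx, feeds_self hbZ, hsb⟩
  · exact hlinked

end Feeds

section FeedModel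

variable {V : Type w} (G : GDAG V) (Z : Set V)

open Classical in
/-- The bits among `r` of the nodes that feed `v`. -/
noncomputable def feed (r : V → Bool) (v : V) : Finset Bool :=
  {b | ∃ s, G.Feeds Z s v ∧ r s = b}

open Classical in
/-- What the node `v` passes on of the set `s` of bits that it receives: a node of `Z` only tells
whether both bits occur. -/
noncomputable def release (v : V) (s : Finset Bool) : Finset Bool :=
  if v ∈ Z → s = Finset.univ then s else ∅

variable {G Z} {r : V → Bool} {v : V} {b : Bool}

theorem mem_feed : b ∈ G.feed Z r v ↔ ∃ s, G.Feeds Z s v ∧ r s = b := by simp [feed]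

theorem release_of_notMem (hv : v ∉ Z) (s : Finset Bool) : release Z v s = s :=
  if_pos fun h => absurd h hv

theorem release_of_mem (hv : v ∈ Z) {s : Finset Bool} (hs : s ≠ Finset.univ) :
    release Z v s = ∅ :=
  if_neg fun h => hs (h hv)

theorem mem_feed_iff : b ∈ G.feed Z r v ↔
    (v ∉ Z ∧ r v = b) ∨ ∃ p : {p // G.edge p v}, p.1 ∉ Z ∧ b ∈ release Z p (G.feed Z r p) := by
  have hparent (p : V) :
      (p ∉ Z ∧ b ∈ release Z p (G.feed Z r p)) ↔ p ∉ Z ∧ ∃ s, G.Feeds Z s p ∧ r s = b :=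
    and_congr_right fun hp => by rw [release_of_notMem hp, mem_feed]
  simp only [hparent, mem_feed, feeds_iff (v := v)]
  constructor
  · rintro ⟨s, ⟨hv, rfl⟩ | ⟨p, hp, hs⟩, hsb⟩
    exacts [.inl ⟨hv, hsb⟩, .inr ⟨p, hp, s, hs, hsb⟩]
  · rintro (⟨hv, hb⟩ | ⟨p, hp, s, hs, hsb⟩)
    exacts [⟨v, .inl ⟨hv, rfl⟩, hb⟩, ⟨s, .inr ⟨p, hp, hs⟩, hsb⟩]

variable (G Z) in
open Classical in
/-- Every node outside `Z` has a fair bit as noise. It collects this bit and all that it receives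
from its parents outside `Z`. -/
noncomputable def feedModel : FunctionalModel G Bool (Finset Bool) where
  mechanism v β y := release Z v {b | (v ∉ Z ∧ β = b) ∨ ∃ p, p.1 ∉ Z ∧ b ∈ y p}
  value r v := release Z v (G.feed Z r v)
  value_eq r v := by
    congr 1
    ext b
    rw [mem_feed_iff, Finset.mem_filter_univ]

theorem feed_const_subset (b : Bool) (v : V) : G.feed Z (fun _ => b) v ⊆ {b} := by
  intro c hc
  obtain ⟨_, _, rfl⟩ := mem_feed.1 hc
  exact Finset.mem_singleton_self _

theorem feedModel_value_const_of_mem (b : Bool) (hv : v ∈ Z) :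
    (G.feedModel Z).value (fun _ => b) v = ∅ :=
  release_of_mem hv fun huniv => Bool.not_ne_self b <| Finset.mem_singleton.1 <|
    feed_const_subset b v (huniv ▸ Finset.mem_univ _)

theorem eq_of_feedModel_value_eq_const (hv : v ∉ Z)
    (h : (G.feedModel Z).value r v = (G.feedModel Z).value (fun _ => b) v) {s : V}
    (hs : G.Feeds Z s v) : r s = b := by
  have hfeed : release Z v (G.feed Z r v) = release Z v (G.feed Z (fun _ => b) v) := h
  rw [release_of_notMem hv, release_of_notMem hv] at hfeed
  exact Finset.mem_singleton.1 (feed_const_subset b v (hfeed ▸ mem_feed.2 ⟨s, hs, rfl⟩))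

theorem eq_of_linked (hr : ∀ z ∈ Z, (G.feedModel Z).value r z = ∅) {s t : V}
    (h : G.Linked Z s t) : r s = r t := by
  induction h with
  | refl => rfl
  | @tail p p' _ hpp' ih =>
    obtain ⟨z, hz, hp, hp'⟩ := hpp'
    refine ih.trans ?_
    by_contra hne
    have huniv : G.feed Z r z = Finset.univ :=
      Finset.eq_univ_iff_forall.2 fun b => mem_feed.2 <| by
        rcases eq_or_ne (r p) b with rfl | hb
        exacts [⟨p, hp, rfl⟩,
          ⟨p', hp', (Bool.eq_not.2 (Ne.symm hne)).trans (Bool.eq_not.2 hb.symm).symm⟩]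
    have hempty : release Z z (G.feed Z r z) = ∅ := hr z hz
    rw [huniv, release, if_pos fun _ => rfl] at hempty
    exact Finset.univ_nonempty.ne_empty hempty

end FeedModel

variable {V : Type w} [Fintype V] [DecidableEq V] {G : GDAG V} {X Y Z : Set V}

theorem not_condIndepSets_law_feedModel (hX : X ⊆ G.observed) (hY : Y ⊆ G.observed)
    (hZ : Z ⊆ G.observed) (hXY : Disjoint X Y) (hXZ : Disjoint X Z) (hYZ : Disjoint Y Z)
    (h : ¬ G.DSep X Y Z) :
    ¬ CondIndepSets (Ω := fun _ => Finset Bool) (G.feedModel Z).law X Y Z := by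
  classical
  obtain ⟨x, hx, y, hy, s, t, hsx, hty, hst⟩ := exists_linked_of_not_dSep hXZ h
  let a (i : G.observed) : Finset Bool :=
    (G.feedModel Z).value (fun _ => decide ((i : V) ∈ Y)) i
  have haX (i : G.observed) (hi : (i : V) ∈ X) :
      (G.feedModel Z).value (fun _ => false) i = a i := by
    simp only [a, Set.disjoint_left.1 hXY hi, decide_false]
  have haY (i : G.observed) (hi : (i : V) ∈ Y) :
      (G.feedModel Z).value (fun _ => true) i = a i := by
    simp only [a, hi, decide_true]
  have haZ (b) (i : G.observed) (hi : (i : V) ∈ Z) :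
      (G.feedModel Z).value (fun _ => b) i = a i := by
    simp only [a, feedModel_value_const_of_mem _ hi]
  have hZ_ne : marginal (G.feedModel Z).law Z a ≠ 0 :=
    (FunctionalModel.marginal_law_ne_zero_iff _).2 ⟨_, haZ false⟩
  have hXZ_ne : marginal (G.feedModel Z).law (X ∪ Z) a ≠ 0 :=
    (FunctionalModel.marginal_law_ne_zero_iff _).2 ⟨_, fun i => Or.rec (haX i) (haZ false i)⟩
  have hYZ_ne : marginal (G.feedModel Z).law (Y ∪ Z) a ≠ 0 :=
    (FunctionalModel.marginal_law_ne_zero_iff _).2 ⟨_, fun i => Or.rec (haY i) (haZ true i)⟩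
  have hXYZ_eq : marginal (G.feedModel Z).law (X ∪ Y ∪ Z) a = 0 := by
    by_contra hne
    obtain ⟨r, hr⟩ := (FunctionalModel.marginal_law_ne_zero_iff _).1 hne
    have hs : r s = false := eq_of_feedModel_value_eq_const (Set.disjoint_left.1 hXZ hx)
      ((hr ⟨x, hX hx⟩ (.inl (.inl hx))).trans (haX ⟨x, hX hx⟩ hx).symm) hsx
    have ht : r t = true := eq_of_feedModel_value_eq_const (Set.disjoint_left.1 hYZ hy)
      ((hr ⟨y, hY hy⟩ (.inl (.inr hy))).trans (haY ⟨y, hY hy⟩ hy).symm) hty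
    have hst : r s = r t := eq_of_linked (fun z hz => (hr ⟨z, hZ hz⟩ (.inr hz)).trans
      (feedModel_value_const_of_mem _ hz)) hst
    simp [hs, ht] at hst
  intro hind
  have hmul := hind a hZ_ne
  rw [hXYZ_eq, zero_div] at hmul
  exact mul_ne_zero (div_ne_zero hXZ_ne hZ_ne) (div_ne_zero hYZ_ne hZ_ne) hmul.symm

end GDAG

theorem theorem3 {V : Type w} [Fintype V] [DecidableEq V] (G : GDAG V) (X Y Z : Set V)
    (hX : X ⊆ G.observed) (hY : Y ⊆ G.observed) (hZ : Z ⊆ G.observed)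
    (hXY : Disjoint X Y) (hXZ : Disjoint X Z) (hYZ : Disjoint Y Z) :
    (∀ (Ω : G.observed → Type) [∀ i, Fintype (Ω i)] (P : (∀ i, Ω i) → ℝ),
      P ∈ stdSimplex ℝ (∀ i, Ω i) → G.IsGeneralisedMarkov.{u, w} P →
      G.DSep X Y Z → CondIndepSets P X Y Z) ∧
    ((∀ (Ω : G.observed → Type) [∀ i, Fintype (Ω i)] (P : (∀ i, Ω i) → ℝ),
      P ∈ stdSimplex ℝ (∀ i, Ω i) → G.IsGeneralisedMarkov.{u, w} P →
      CondIndepSets P X Y Z) → G.DSep X Y Z) := by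
  refine ⟨fun Ω _ P _ hP hsep => hP.condIndepSets hZ hXZ hYZ hsep, fun h => ?_⟩
  by_contra hsep
  exact GDAG.not_condIndepSets_law_feedModel hX hY hZ hXY hXZ hYZ hsep
    (h _ _ (G.feedModel Z).law_mem_stdSimplex (G.feedModel Z).isGeneralisedMarkov_law)
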